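/- Let $F_0=0$, $F_1=1$, $F_k=F_{k-1}+F_{k-2}$ be the Fibonacci numbers and $\gamma=(1+\sqrt5)/2$. Every non-negative integer $n$ has a unique Zeckendorf expansion $n=\sum_{i\ge 2}\delta_i(n)F_i$ with $\delta_i(n)\in\{0,1\}$, $\delta_i(n)\delta_{i+1}(n)=0$, and only finitely many non-zero digits. A function $f:\{0,1,2,\dots\}\to\mathbb R$ is called Z-additive if $f(n)=\sum_{i\ge 2,\ \delta_i(n)=1} f(F_i)$ for all $n\ge 0$ (in particular $f(0)=0$). We say that $f$ has the (limiting) distribution function $F$, where $F$ is the distribution function $F(y)=\mu((-\infty,y])$ of a probability measure $\mu$ on $\mathbb R$, if $$\lim_{N\to\infty}\frac1N\#\{0\le n<N: f(n)\le y\}=F(y)\qquad(\ast)$$ at every point of continuity $y$ of $F$. **Theorem (Zeckendorf Erdős–Wintner theorem).** Let $f$ be a real-valued Z-additive function. Then $f$ has a distribution function if and only if the two series $$\sum_{j\ge2} f(F_j)\quad\text{and}\quad\sum_{j\ge2} f(F_j)^2$$ converge (in the sense of partial sums). In this case $(\ast)$ holds for every real $y$, and the characteristic function $\varphi(t)=\int_{-\infty}^{\infty}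 e^{ity}\,dF(y)$ of the limiting distribution is given by $$\varphi(t)=\frac{\sqrt5}{\gamma}\prod_{j\ge2}\frac{r_j(t)}{\gamma} =\lim_{k\to\infty}\frac{\sqrt5}{\gamma}\prod_{j=2}^{k}\frac{r_j(t)}{\gamma},$$ where $r_2(t)=1$ and $r_{j+1}(t)=1+e^{itf(F_j)}/r_j(t)$ for $j\ge2$, for every real $t$ such that $r_j(t)\ne0$ for all $j\ge2$. -/

import Mathlib

open Filter Topology MeasureTheory ProbabilityTheory

/-- `f` is Z-additive: its value at `n` is the sum of its values at the Fibonacci numbers occurring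
in the Zeckendorf expansion of `n` (`Nat.zeckendorf n` is the list of their indices, all `≥ 2`
and pairwise non-consecutive). For `n = 0` the expansion is empty, so `f 0 = 0`. -/
def IsZAdditive (f : ℕ → ℝ) : Prop :=
  ∀ n : ℕ, f n = ((Nat.zeckendorf n).map fun i => f (Nat.fib i)).sum

/-- The proportion `#{n < N : f n ≤ y} / N`. -/
noncomputable def empiricalDistribution (f : ℕ → ℝ) (N : ℕ) (y : ℝ) : ℝ :=
  (((Finset.range N).filter fun n => f n ≤ y).card : ℝ) / (N : ℝ)

/-- `f` has the distribution function `F y = μ (-∞, y]` of the probability measure `μ` as its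
(limiting) distribution function: the proportions `#{n < N : f n ≤ y} / N` tend to `F y` at every
point of continuity `y` of `F`. -/
def HasDistributionFunction (f : ℕ → ℝ) (μ : ProbabilityMeasure ℝ) : Prop :=
  ∀ y : ℝ, ContinuousAt (cdf (μ : Measure ℝ)) y →
    Tendsto (fun N : ℕ => empiricalDistribution f N y) atTop (𝓝 (cdf (μ : Measure ℝ) y))

/-- The series `∑_{j ≥ 2} a j` converges (possibly only conditionally): its partial sums have a
finite limit. -/
def SeriesConvergesFromTwo (a : ℕ → ℝ) : Prop :=
  ∃ s : ℝ, Tendsto (fun n : ℕ => ∑ j ∈ Finset.Icc 2 n, a j) atTop (𝓝 s)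

/-- The sequence `r_j(t)`, `j ≥ 2`, given by `r_2(t) = 1` and
`r_{j+1}(t) = 1 + e^{i t f(F_j)} / r_j(t)` for `j ≥ 2`. The values at `j = 0, 1` are irrelevant, and
so are the values that follow a zero of the sequence. -/
noncomputable def zRatio (f : ℕ → ℝ) (t : ℝ) : ℕ → ℂ
  | j + 3 => 1 + Complex.exp (Complex.I * (t : ℂ) * (f (Nat.fib (j + 2)) : ℂ)) / zRatio f t (j + 2)
  | _ => 1

/-!
Write `a_k = f (F_{k+2})` and `s_k(t) = ∑_{n < F_{k+1}} e^{i t f(n)}`. Splitting off the leading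
Zeckendorf digit gives the Fibonacci recursion `s_{k+2} = s_{k+1} + e^{i t a_k} s_k` twisted by
phases (`zSum_fib`), and the ratios `r_j(t)` are the quotients of consecutive `s_k`
(`prod_zRatio_eq`). Everything follows from two properties of this recursion.

* *Decay.* A phase `e^{i t a_k} ≠ 1` makes `|s_k| / F_{k+1}` contract, so that for `k ≥ K + 2` this
  quotient is at most `exp (-∑_{1 ≤ j ≤ K} (1 - cos (t a_j)) / 36)`
  (`norm_fibTwist_div_pow_three_le`).
* *Asymptotics.* Let `∑ a_j ^ 2` converge. In the eigenbasis of the Fibonacci matrix, and after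
  division by `γ ^ k`, the dominant coordinate is multiplied at each step by `e^{i c t a_k}`, `c = 1 / (√5 γ)`, up to summable errors,
  and the other coordinate tends to zero. Hence `e^{-i c t (a_0 + ⋯ + a_{k-1})} s_k / F_{k+1}`
  converges to a limit that is continuous at `t = 0` with value `1` there
  (`exists_tendsto_centred`).

*Sufficiency.* If both series converge, the asymptotics give the limit of the means of `e^{i t f}`
over `n < F_k`; a block decomposition extends it to `n < N` (`tendsto_zSum_div`), and Lévy's
continuity theorem gives a limiting distribution.

*Necessity.* If a limiting distribution exists, its characteristic function `φ` is near `1` for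
small `t`, so the decay bounds `∑ (1 - cos (t a_j))` uniformly there; integrating in `t` yields
`∑ a_j ^ 2 < ∞`. The asymptotics then show that `e^{i c t (a_0 + ⋯ + a_{k-1})}` converges for some
`t ≠ 0`, and since `a_k → 0` the sums `a_0 + ⋯ + a_{k-1}` converge.

*Convergence at every point.* If infinitely many `a_j` are nonzero, infinitely many of the `|a_j|`
are distinct, because `a_j → 0`. The functions `cos (t a_j)` with distinct frequencies are orthogonal
in mean, so by Chebyshev's inequality and the decay the mean of `|φ|` over `[0, T]` tends to zero,
and the limit has no atoms (`HasDistributionFunction.measure_singleton_eq_zero`). Otherwise `f` has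
finitely many values and the claim is elementary.
-/

/-! ### Exponential sums over initial segments and the twisted Fibonacci recursion -/

/-- The value `f (F_{k+2})`: the contribution of the `k`-th Zeckendorf digit. -/
def zCoeff (f : ℕ → ℝ) (k : ℕ) : ℝ := f (Nat.fib (k + 2))

/-- The exponential sum `∑_{n < N} e^{i t f(n)}`. -/
noncomputable def zSum (f : ℕ → ℝ) (t : ℝ) (N : ℕ) : ℂ :=
  ∑ n ∈ Finset.range N, Complex.exp (Complex.I * (t : ℂ) * (f n : ℂ))

/-- The Fibonacci recursion `s (k + 2) = s (k + 1) + e k * s k`, `s 0 = s 1 = 1`, twisted by a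
sequence `e`; for `e = 1` it gives `Nat.fib (k + 1)`. -/
def fibTwist (e : ℕ → ℂ) : ℕ → ℂ
  | 0 => 1
  | 1 => 1
  | k + 2 => fibTwist e (k + 1) + e k * fibTwist e k

/-- The phases `e^{i t a_k}`. -/
noncomputable def phase (a : ℕ → ℝ) (t : ℝ) (k : ℕ) : ℂ :=
  Complex.exp (Complex.I * (t : ℂ) * (a k : ℂ))

theorem fibTwist_add_two (e : ℕ → ℂ) (k : ℕ) :
    fibTwist e (k + 2) = fibTwist e (k + 1) + e k * fibTwist e k := rfl

theorem phase_eq (a : ℕ → ℝ) (t : ℝ) (k : ℕ) :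
    phase a t k = Complex.exp (((t * a k : ℝ) : ℂ) * Complex.I) := by
  unfold phase; congr 1; push_cast; ring

theorem norm_phase (a : ℕ → ℝ) (t : ℝ) (k : ℕ) : ‖phase a t k‖ = 1 := by
  rw [phase_eq, Complex.norm_exp_ofReal_mul_I]

theorem re_phase (a : ℕ → ℝ) (t : ℝ) (k : ℕ) : (phase a t k).re = Real.cos (t * a k) := by
  rw [phase_eq, Complex.exp_ofReal_mul_I_re]

theorem Nat.zeckendorf_fib_add {k m : ℕ} (hm : m < Nat.fib (k + 1)) :
    Nat.zeckendorf (Nat.fib (k + 2) + m) = (k + 2) :: Nat.zeckendorf m := by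
  have hpos : 0 < Nat.fib (k + 2) := Nat.fib_pos.2 (by omega)
  have h1 : Nat.greatestFib (Nat.fib (k + 2) + m) = k + 2 := by
    apply le_antisymm
    · rw [← Nat.lt_succ_iff, Nat.greatestFib_lt, Nat.succ_eq_add_one, Nat.fib_add_two (n := k + 1)]
      have : k + 1 + 1 = k + 2 := rfl
      rw [this]; omega
    · rw [Nat.le_greatestFib]; omega
  rw [Nat.zeckendorf_of_pos (by omega), h1, Nat.add_sub_cancel_left]

theorem IsZAdditive.map_zero {f : ℕ → ℝ} (hf : IsZAdditive f) : f 0 = 0 := by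
  simpa using hf 0

theorem IsZAdditive.map_fib_add {f : ℕ → ℝ} (hf : IsZAdditive f) {k m : ℕ}
    (hm : m < Nat.fib (k + 1)) : f (Nat.fib (k + 2) + m) = zCoeff f k + f m := by
  rw [hf (Nat.fib (k + 2) + m), Nat.zeckendorf_fib_add hm, List.map_cons, List.sum_cons, ← hf m]
  rfl

/-- Every integer `n ≥ 1` is `F_{k+2} + m` with `m < F_{k+1}`: split off the leading digit. -/
theorem exists_eq_fib_add {n : ℕ} (hn : 0 < n) :
    ∃ k m, m < Nat.fib (k + 1) ∧ n = Nat.fib (k + 2) + m := by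
  have h2 : 2 ≤ Nat.greatestFib n := by rw [Nat.le_greatestFib, Nat.fib_two]; exact hn
  obtain ⟨k, hk⟩ := Nat.exists_eq_add_of_le' h2
  have h3 := Nat.fib_greatestFib_le n
  have h4 := Nat.lt_fib_greatestFib_add_one n
  rw [hk] at h3 h4
  rw [Nat.fib_add_two (n := k + 1)] at h4
  exact ⟨k, n - Nat.fib (k + 2), by rw [show k + 1 + 1 = k + 2 from rfl] at h4; omega, by omega⟩

theorem zSum_fib_add {f : ℕ → ℝ} (hf : IsZAdditive f) (t : ℝ) {k M : ℕ}
    (hM : M ≤ Nat.fib (k + 1)) :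
    zSum f t (Nat.fib (k + 2) + M) =
      zSum f t (Nat.fib (k + 2)) + phase (zCoeff f) t k * zSum f t M := by
  unfold zSum
  rw [Finset.sum_range_add, Finset.mul_sum]
  congr 1
  refine Finset.sum_congr rfl fun m hm => ?_
  rw [hf.map_fib_add (lt_of_lt_of_le (Finset.mem_range.1 hm) hM), phase, ← Complex.exp_add]
  congr 1; push_cast; ring

theorem zSum_fib {f : ℕ → ℝ} (hf : IsZAdditive f) (t : ℝ) (k : ℕ) :
    zSum f t (Nat.fib (k + 1)) = fibTwist (phase (zCoeff f) t) k := by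
  induction k using Nat.twoStepInduction with
  | zero => simp [zSum, fibTwist, hf.map_zero]
  | one => simp [zSum, fibTwist, hf.map_zero]
  | more k h1 h2 =>
    rw [fibTwist_add_two, ← h1, ← h2, ← zSum_fib_add hf t le_rfl, Nat.fib_add_two (n := k + 1),
      add_comm]

theorem norm_zSum_le (f : ℕ → ℝ) (t : ℝ) (N : ℕ) : ‖zSum f t N‖ ≤ N := by
  refine (norm_sum_le _ _).trans ?_
  have : ∀ n, ‖Complex.exp (Complex.I * (t : ℂ) * (f n : ℂ))‖ = 1 := fun n => norm_phase f t n
  simp [this]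

/-- As long as no ratio vanishes, `r_j(t)` is the quotient of two consecutive exponential sums, so
the product telescopes. -/
theorem prod_zRatio_eq {f : ℕ → ℝ} {t : ℝ} (h : ∀ j : ℕ, 2 ≤ j → zRatio f t j ≠ 0) (k : ℕ) :
    ∏ j ∈ Finset.Icc 2 (k + 1), zRatio f t j = fibTwist (phase (zCoeff f) t) k := by
  have key : ∀ k, fibTwist (phase (zCoeff f) t) (k + 1) =
      fibTwist (phase (zCoeff f) t) k * zRatio f t (k + 2) := by
    intro k
    induction k with
    | zero => simp [fibTwist, zRatio]
    | succ k ih =>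
      have h0 := h (k + 2) (by omega)
      have e : zRatio f t (k + 1 + 2) = 1 + phase (zCoeff f) t k / zRatio f t (k + 2) := rfl
      rw [fibTwist_add_two, e, mul_add, ih]
      field_simp
  induction k with
  | zero => simp [fibTwist]
  | succ k ih => rw [Finset.prod_Icc_succ_top (by omega), ih, key k]

/-- If the mean of `e^{i t f}` over `n < F_k` tends to `φ` and the phases tend to `1`, then so does
the mean over `n < N`. The reason is that `N` splits into blocks of Fibonacci lengths, on each of
which the previous digits contribute a phase close to `1`. -/
theorem tendsto_zSum_div {f : ℕ → ℝ} (hf : IsZAdditive f) {t : ℝ} {φ : ℂ}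
    (h : Tendsto (fun k => fibTwist (phase (zCoeff f) t) k / Nat.fib (k + 1)) atTop (𝓝 φ))
    (ha : Tendsto (zCoeff f) atTop (𝓝 0)) :
    Tendsto (fun N : ℕ => zSum f t N / N) atTop (𝓝 φ) := by
  have hp : Tendsto (phase (zCoeff f) t) atTop (𝓝 1) := by
    have : Tendsto (fun k => Complex.exp (Complex.I * (t : ℂ) * (zCoeff f k : ℂ))) atTop
        (𝓝 (Complex.exp (Complex.I * (t : ℂ) * ((0 : ℝ) : ℂ)))) :=
      (Complex.continuous_exp.tendsto _).comp
        (((Complex.continuous_ofReal.tendsto _).comp ha).const_mul _)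
    rw [Complex.ofReal_zero, mul_zero, Complex.exp_zero] at this
    exact this
  rw [Metric.tendsto_atTop] at h hp
  have key : ∀ ε > 0, ∃ C : ℝ, 0 ≤ C ∧ ∀ N : ℕ, ‖zSum f t N - φ * N‖ ≤ C + 2 * ε * N := by
    intro ε hε
    obtain ⟨K1, h1⟩ := h ε hε
    obtain ⟨K2, h2⟩ := hp ε hε
    set K := max K1 K2 with hK
    refine ⟨(1 + ‖φ‖) * Nat.fib (K + 2), by positivity, fun N => ?_⟩
    induction N using Nat.strong_induction_on with
    | _ N ih =>
      by_cases hN : N < Nat.fib (K + 2)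
      · have hN' : (N : ℝ) ≤ Nat.fib (K + 2) := by exact_mod_cast hN.le
        calc ‖zSum f t N - φ * N‖ ≤ ‖zSum f t N‖ + ‖φ * N‖ := norm_sub_le _ _
          _ ≤ N + ‖φ‖ * N := by
            rw [norm_mul, Complex.norm_natCast]; gcongr; exact norm_zSum_le f t N
          _ = (1 + ‖φ‖) * N := by ring
          _ ≤ (1 + ‖φ‖) * Nat.fib (K + 2) := by gcongr
          _ ≤ _ := le_add_of_nonneg_right (by positivity)
      · have hNpos : 0 < N := lt_of_lt_of_le (Nat.fib_pos.2 (by omega)) (not_lt.1 hN)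
        obtain ⟨k, m, hm, rfl⟩ := exists_eq_fib_add hNpos
        have hk : K ≤ k := by
          by_contra hlt
          have h3 : Nat.fib (k + 3) ≤ Nat.fib (K + 2) := Nat.fib_mono (by omega)
          have h4 : Nat.fib (k + 3) = Nat.fib (k + 1) + Nat.fib (k + 2) := Nat.fib_add_two
          omega
        have hmF : m ≤ Nat.fib (k + 2) := hm.le.trans (Nat.fib_mono (by omega))
        have hpos : 0 < Nat.fib (k + 2) := Nat.fib_pos.2 (by omega)
        have e1 : ‖zSum f t (Nat.fib (k + 2)) - φ * Nat.fib (k + 2)‖ ≤ ε * Nat.fib (k + 2) := by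
          have := (h1 (k + 1) (by omega)).le
          rw [dist_eq_norm, ← zSum_fib hf, show k + 1 + 1 = k + 2 from rfl] at this
          have hne : (Nat.fib (k + 2) : ℂ) ≠ 0 := by exact_mod_cast hpos.ne'
          have e : zSum f t (Nat.fib (k + 2)) - φ * Nat.fib (k + 2) =
              (zSum f t (Nat.fib (k + 2)) / Nat.fib (k + 2) - φ) * Nat.fib (k + 2) := by
            field_simp
          rw [e, norm_mul, Complex.norm_natCast]
          gcongr
        have e2 : ‖(phase (zCoeff f) t k - 1) * zSum f t m‖ ≤ ε * Nat.fib (k + 2) := by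
          have := (h2 k (by omega)).le
          rw [dist_eq_norm] at this
          rw [norm_mul]
          gcongr
          exact (norm_zSum_le f t m).trans (by exact_mod_cast hmF)
        have e3 := ih m (by omega)
        rw [zSum_fib_add hf t hm.le]
        have e : zSum f t (Nat.fib (k + 2)) + phase (zCoeff f) t k * zSum f t m
            - φ * ((Nat.fib (k + 2) + m : ℕ) : ℂ) =
            (zSum f t (Nat.fib (k + 2)) - φ * Nat.fib (k + 2)) +
            (phase (zCoeff f) t k - 1) * zSum f t m + (zSum f t m - φ * m) := by
          push_cast; ring
        rw [e]
        refine (norm_add₃_le).trans ?_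
        push_cast
        linarith
  rw [Metric.tendsto_atTop]
  intro ε hε
  obtain ⟨C, hC0, hC⟩ := key (ε / 8) (by positivity)
  obtain ⟨N0, hN0⟩ := exists_nat_gt (4 * C / ε)
  refine ⟨N0 + 1, fun N hN => ?_⟩
  have hNpos : (0 : ℝ) < N := by exact_mod_cast (by omega : 0 < N)
  have hne : (N : ℂ) ≠ 0 := by exact_mod_cast hNpos.ne'
  have hNN : (N0 : ℝ) ≤ N := by exact_mod_cast (by omega : N0 ≤ N)
  have h4 : C ≤ ε / 4 * N := by
    rw [div_lt_iff₀ hε] at hN0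
    nlinarith
  have e : zSum f t N / N - φ = (zSum f t N - φ * N) / N := by field_simp
  rw [dist_eq_norm, e, norm_div, Complex.norm_natCast, div_lt_iff₀ hNpos]
  have := hC N
  nlinarith

/-! ### Exponential decay of the twisted recursion -/

theorem norm_one_add_le {z : ℂ} (hz : ‖z‖ = 1) : ‖1 + z‖ ≤ 2 - (1 - z.re) / 2 := by
  have h1 : z.re ^ 2 + z.im ^ 2 = 1 := by
    have := Complex.sq_norm z
    rw [hz, Complex.normSq_apply] at this; nlinarith
  have h2 : ‖1 + z‖ ^ 2 = 2 + 2 * z.re := by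
    rw [Complex.sq_norm, Complex.normSq_apply]; simp; nlinarith
  have h3 : z.re ≤ 1 := (Complex.re_le_norm z).trans hz.le
  have h4 : -1 ≤ z.re := by nlinarith
  refine le_of_sq_le_sq ?_ (by linarith)
  rw [h2]; nlinarith [sq_nonneg (1 - z.re)]

/-- The larger of two consecutive normalised values `|s_k| / F_{k+1}`; it decreases with `k`. -/
noncomputable def twistBound (e : ℕ → ℂ) (k : ℕ) : ℝ :=
  max (‖fibTwist e k‖ / Nat.fib (k + 1)) (‖fibTwist e (k + 1)‖ / Nat.fib (k + 2))

theorem twistBound_nonneg (e : ℕ → ℂ) (k : ℕ) : 0 ≤ twistBound e k :=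
  le_max_of_le_left (by positivity)

theorem fib_succ_pos (k : ℕ) : (0 : ℝ) < Nat.fib (k + 1) := by
  exact_mod_cast Nat.fib_pos.2 (Nat.succ_pos k)

theorem norm_fibTwist_le (e : ℕ → ℂ) (k : ℕ) :
    ‖fibTwist e k‖ ≤ twistBound e k * Nat.fib (k + 1) := by
  rw [← div_le_iff₀ (fib_succ_pos k)]; exact le_max_left _ _

theorem norm_fibTwist_succ_le (e : ℕ → ℂ) (k : ℕ) :
    ‖fibTwist e (k + 1)‖ ≤ twistBound e k * Nat.fib (k + 2) := by
  rw [← div_le_iff₀ (fib_succ_pos (k + 1))]; exact le_max_right _ _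

theorem twistBound_le {e : ℕ → ℂ} {k : ℕ} {x : ℝ} (h0 : ‖fibTwist e k‖ ≤ x * Nat.fib (k + 1))
    (h1 : ‖fibTwist e (k + 1)‖ ≤ x * Nat.fib (k + 2)) : twistBound e k ≤ x :=
  max_le ((div_le_iff₀ (fib_succ_pos k)).2 h0) ((div_le_iff₀ (fib_succ_pos (k + 1))).2 h1)

theorem fib_cast_add_two (k : ℕ) : (Nat.fib (k + 2) : ℝ) = Nat.fib k + Nat.fib (k + 1) := by
  exact_mod_cast Nat.fib_add_two

theorem norm_fibTwist_add_two_le {e : ℕ → ℂ} (he : ∀ k, ‖e k‖ = 1) (k : ℕ) :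
    ‖fibTwist e (k + 2)‖ ≤ ‖fibTwist e (k + 1)‖ + ‖fibTwist e k‖ := by
  rw [fibTwist_add_two]
  refine (norm_add_le _ _).trans ?_
  rw [norm_mul, he, one_mul]

theorem twistBound_succ_le {e : ℕ → ℂ} (he : ∀ k, ‖e k‖ = 1) (k : ℕ) :
    twistBound e (k + 1) ≤ twistBound e k := by
  refine twistBound_le (norm_fibTwist_succ_le e k) ?_
  have h := norm_fibTwist_add_two_le he k
  have h0 := norm_fibTwist_le e k
  have h1 := norm_fibTwist_succ_le e k
  rw [fib_cast_add_two (k + 1)]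
  linarith

theorem twistBound_antitone {e : ℕ → ℂ} (he : ∀ k, ‖e k‖ = 1) : Antitone (twistBound e) :=
  antitone_nat_of_succ_le (twistBound_succ_le he)

/-- A nontrivial phase strictly contracts the bound: in `s_{k+3} = (1 + e_{k+1}) s_{k+1} + e_k s_k`
the factor `1 + e_{k+1}` is smaller than `2` in modulus. -/
theorem twistBound_add_three_le {e : ℕ → ℂ} (he : ∀ k, ‖e k‖ = 1) (k : ℕ) :
    twistBound e (k + 3) ≤ Real.exp (-((1 - (e (k + 1)).re) / 12)) * twistBound e k := by
  set d := (1 - (e (k + 1)).re) / 2 with hd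
  set m := twistBound e k with hm
  have hm0 : 0 ≤ m := twistBound_nonneg e k
  have hd0 : 0 ≤ d := by
    have := (Complex.re_le_norm (e (k + 1))).trans (he _).le
    rw [hd]; linarith
  have h0 := norm_fibTwist_le e k
  have h1 := norm_fibTwist_succ_le e k
  have h2 : ‖fibTwist e (k + 2)‖ ≤ m * Nat.fib (k + 3) :=
    (norm_fibTwist_succ_le e (k + 1)).trans (by gcongr; exact twistBound_succ_le he k)
  have g1 := fib_cast_add_two (k + 1)
  have g2 := fib_cast_add_two (k + 2)
  have g3 := fib_cast_add_two (k + 3)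
  have p1 := fib_succ_pos k
  have p2 := fib_succ_pos (k + 1)
  have p12 : (Nat.fib (k + 1) : ℝ) ≤ Nat.fib (k + 2) := by exact_mod_cast Nat.fib_mono (by omega)
  simp only [add_assoc, Nat.reduceAdd] at g1 g2 g3 p2
  have h3 : ‖fibTwist e (k + 3)‖ ≤ m * (Nat.fib (k + 4) - d * Nat.fib (k + 2)) := by
    have e3 : fibTwist e (k + 3) =
        (1 + e (k + 1)) * fibTwist e (k + 1) + e k * fibTwist e k := by
      rw [fibTwist_add_two e (k + 1), fibTwist_add_two e k]; ring
    rw [e3]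
    refine (norm_add_le _ _).trans ?_
    rw [norm_mul, norm_mul, he, one_mul]
    have := norm_one_add_le (he (k + 1))
    calc ‖1 + e (k + 1)‖ * ‖fibTwist e (k + 1)‖ + ‖fibTwist e k‖
        ≤ (2 - d) * (m * Nat.fib (k + 2)) + m * Nat.fib (k + 1) := by
          gcongr
          exact (norm_nonneg _).trans this
      _ = _ := by rw [g2, g1]; ring
  have h4 := norm_fibTwist_add_two_le he (k + 2)
  have hmd : 0 ≤ m * d := mul_nonneg hm0 hd0
  -- `3` and `6` bound `F_{k+4} / F_{k+2}` and `F_{k+5} / F_{k+2}`.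
  have hb : twistBound e (k + 3) ≤ (1 - d / 6) * m := by
    refine twistBound_le ?_ ?_
    · refine h3.trans ?_
      have : (Nat.fib (k + 4) : ℝ) ≤ 3 * Nat.fib (k + 2) := by rw [g2, g1]; linarith
      nlinarith [mul_le_mul_of_nonneg_left this hmd]
    · have : (Nat.fib (k + 5) : ℝ) ≤ 6 * Nat.fib (k + 2) := by rw [g3, g2, g1]; linarith
      have := mul_le_mul_of_nonneg_left this hmd
      simp only [add_assoc, Nat.reduceAdd] at h4 ⊢
      rw [g3] at this ⊢
      nlinarith
  refine hb.trans ?_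
  gcongr
  have := Real.add_one_le_exp (-((1 - (e (k + 1)).re) / 12))
  linarith

theorem twistBound_zero_le (e : ℕ → ℂ) : twistBound e 0 ≤ 1 := by simp [twistBound, fibTwist]

theorem twistBound_le_one {e : ℕ → ℂ} (he : ∀ k, ‖e k‖ = 1) (k : ℕ) : twistBound e k ≤ 1 :=
  (twistBound_antitone he (Nat.zero_le k)).trans (twistBound_zero_le e)

/-- Three consecutive bounds are multiplied so that every phase contributes to the decay. -/
theorem twistBound_pow_three_le {e : ℕ → ℂ} (he : ∀ k, ‖e k‖ = 1) (K : ℕ) :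
    twistBound e (K + 2) ^ 3 ≤
      Real.exp (-(∑ j ∈ Finset.range K, (1 - (e (j + 1)).re) / 12)) := by
  have key : ∀ K, twistBound e K * twistBound e (K + 1) * twistBound e (K + 2) ≤
      Real.exp (-(∑ j ∈ Finset.range K, (1 - (e (j + 1)).re) / 12)) := by
    intro K
    have n := twistBound_nonneg e
    induction K with
    | zero =>
      simp only [Finset.range_zero, Finset.sum_empty, neg_zero, Real.exp_zero]
      have b := twistBound_le_one he
      exact mul_le_one₀ (mul_le_one₀ (b _) (n _) (b _)) (n _) (b _)
    | succ K ih =>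
      rw [Finset.sum_range_succ, neg_add, Real.exp_add]
      have h := twistBound_add_three_le he K
      calc twistBound e (K + 1) * twistBound e (K + 1 + 1) * twistBound e (K + 1 + 2)
          = twistBound e (K + 1) * twistBound e (K + 2) * twistBound e (K + 3) := rfl
        _ ≤ twistBound e (K + 1) * twistBound e (K + 2) *
            (Real.exp (-((1 - (e (K + 1)).re) / 12)) * twistBound e K) := by
            gcongr; exact mul_nonneg (n _) (n _)
        _ = (twistBound e K * twistBound e (K + 1) * twistBound e (K + 2)) *
            Real.exp (-((1 - (e (K + 1)).re) / 12)) := by ring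
        _ ≤ _ := by gcongr
  refine le_trans ?_ (key K)
  have a := twistBound_antitone he
  have n := twistBound_nonneg e
  rw [pow_succ, pow_two]
  gcongr
  · exact n _
  · exact n _
  · exact n _
  · exact a (by omega)
  · exact a (by omega)

theorem norm_fibTwist_div_pow_three_le {e : ℕ → ℂ} (he : ∀ k, ‖e k‖ = 1) {K k : ℕ}
    (hk : K + 2 ≤ k) : ‖fibTwist e k / Nat.fib (k + 1)‖ ^ 3 ≤
      Real.exp (-(∑ j ∈ Finset.range K, (1 - (e (j + 1)).re) / 12)) := by
  refine le_trans ?_ (twistBound_pow_three_le he K)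
  gcongr
  refine le_trans ?_ (twistBound_antitone he hk)
  rw [norm_div, Complex.norm_natCast]
  exact le_max_left _ _

theorem norm_fibTwist_le_fib {e : ℕ → ℂ} (he : ∀ k, ‖e k‖ = 1) (k : ℕ) :
    ‖fibTwist e k‖ ≤ Nat.fib (k + 1) := by
  refine (norm_fibTwist_le e k).trans ?_
  exact mul_le_of_le_one_left (by positivity) (twistBound_le_one he k)

/-! ### Distribution functions, weak convergence and characteristic functions -/

/-- The uniform probability measure on the values `f 0, …, f N`. -/
noncomputable def empiricalMeasure (f : ℕ → ℝ) (N : ℕ) : ProbabilityMeasure ℝ :=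
  ⟨((N + 1 : ℕ) : ENNReal)⁻¹ • ∑ n ∈ Finset.range (N + 1), Measure.dirac (f n), ⟨by
    rw [Measure.smul_apply, Measure.finsetSum_apply]
    simp only [measure_univ, Finset.sum_const, Finset.card_range, nsmul_eq_mul, mul_one,
      smul_eq_mul]
    exact ENNReal.inv_mul_cancel (by simp) (by simp)⟩⟩

theorem coe_empiricalMeasure (f : ℕ → ℝ) (N : ℕ) : (empiricalMeasure f N : Measure ℝ) =
    ((N + 1 : ℕ) : ENNReal)⁻¹ • ∑ n ∈ Finset.range (N + 1), Measure.dirac (f n) := rfl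

theorem cdf_empiricalMeasure (f : ℕ → ℝ) (N : ℕ) (y : ℝ) :
    cdf (empiricalMeasure f N : Measure ℝ) y = empiricalDistribution f (N + 1) y := by
  rw [cdf_eq_real, coe_empiricalMeasure, measureReal_ennreal_smul_apply, Measure.real,
    Measure.finsetSum_apply, ENNReal.toReal_sum fun n _ => measure_ne_top _ _]
  simp only [Measure.dirac_apply' _ measurableSet_Iic, Set.indicator_apply, Set.mem_Iic,
    Pi.one_apply]
  unfold empiricalDistribution
  rw [div_eq_inv_mul, Finset.card_filter, ENNReal.toReal_inv, ENNReal.toReal_natCast]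
  congr 1
  push_cast
  refine Finset.sum_congr rfl fun n _ => ?_
  split_ifs <;> simp

theorem charFun_empiricalMeasure (f : ℕ → ℝ) (N : ℕ) (t : ℝ) :
    charFun (empiricalMeasure f N : Measure ℝ) t = zSum f t (N + 1) / ((N + 1 : ℕ) : ℂ) := by
  rw [charFun_apply_real, coe_empiricalMeasure, integral_smul_measure,
    integral_finsetSum_measure (fun n _ => integrable_dirac (by simp))]
  simp only [integral_dirac]
  rw [ENNReal.toReal_inv, ENNReal.toReal_natCast, zSum, div_eq_inv_mul, Complex.real_smul]
  push_cast
  congr 1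
  refine Finset.sum_congr rfl fun n _ => ?_
  congr 1; ring

theorem continuousAt_cdf_iff (μ : ProbabilityMeasure ℝ) (y : ℝ) :
    ContinuousAt (cdf (μ : Measure ℝ)) y ↔ (μ : Measure ℝ) {y} = 0 := by
  have h : (μ : Measure ℝ) {y} = ENNReal.ofReal (cdf (μ : Measure ℝ) y -
      Function.leftLim (cdf (μ : Measure ℝ)) y) := by
    rw [← StieltjesFunction.measure_singleton, measure_cdf]
  have hle := (monotone_cdf (μ : Measure ℝ)).leftLim_le (le_refl y)
  rw [h, ENNReal.ofReal_eq_zero, (monotone_cdf (μ : Measure ℝ)).continuousAt_iff_leftLim_eq_rightLim,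
    (cdf (μ : Measure ℝ)).rightLim_eq]
  constructor
  · intro h; linarith
  · intro h; linarith

theorem exists_continuousAt_cdf (μ : ProbabilityMeasure ℝ) {a b : ℝ} (hab : a < b) :
    ∃ y ∈ Set.Ioo a b, ContinuousAt (cdf (μ : Measure ℝ)) y := by
  have hd : Dense {y | ¬ContinuousAt (cdf (μ : Measure ℝ)) y}ᶜ :=
    (monotone_cdf (μ : Measure ℝ)).countable_not_continuousAt.dense_compl ℝ
  obtain ⟨y, hy, hy'⟩ := hd.exists_between hab
  exact ⟨y, hy', not_not.1 hy⟩

theorem measureReal_Ioc_eq (μ : ProbabilityMeasure ℝ) {a b : ℝ} (hab : a ≤ b) :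
    (μ : Measure ℝ).real (Set.Ioc a b) = cdf (μ : Measure ℝ) b - cdf (μ : Measure ℝ) a := by
  have h : (μ : Measure ℝ).real (Set.Iic b \ Set.Iic a) =
      (μ : Measure ℝ).real (Set.Iic b) - (μ : Measure ℝ).real (Set.Iic a) :=
    measureReal_sdiff (Set.Iic_subset_Iic.2 hab) measurableSet_Iic
  rw [cdf_eq_real, cdf_eq_real, ← h, Set.Iic_sdiff_Iic]

/-- Convergence of the proportions at the continuity points of the limit is weak convergence of the
empirical measures. -/
theorem hasDistributionFunction_iff (f : ℕ → ℝ) (μ : ProbabilityMeasure ℝ) :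
    HasDistributionFunction f μ ↔ Tendsto (empiricalMeasure f) atTop (𝓝 μ) := by
  constructor
  · intro h
    have hcdf : ∀ y, ContinuousAt (cdf (μ : Measure ℝ)) y →
        Tendsto (fun N => cdf (empiricalMeasure f N : Measure ℝ) y) atTop
          (𝓝 (cdf (μ : Measure ℝ) y)) := by
      intro y hy
      simp only [cdf_empiricalMeasure]
      exact (tendsto_add_atTop_iff_nat 1).2 (h y hy)
    let S : Set (Set ℝ) := {s | ∃ a b, a < b ∧ ContinuousAt (cdf (μ : Measure ℝ)) a ∧
      ContinuousAt (cdf (μ : Measure ℝ)) b ∧ s = Set.Ioc a b}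
    have hS : IsPiSystem S := by
      rintro _ ⟨a, b, hab, ha, hb, rfl⟩ _ ⟨c, d, hcd, hc, hd, rfl⟩ hne
      rw [Set.Ioc_inter_Ioc] at hne ⊢
      refine ⟨a ⊔ c, b ⊓ d, Set.nonempty_Ioc.1 hne, ?_, ?_, rfl⟩
      · rcases max_choice a c with h | h <;> rw [h] <;> assumption
      · rcases min_choice b d with h | h <;> rw [h] <;> assumption
    refine hS.tendsto_probabilityMeasure_of_tendsto_of_mem ?_ ?_ ?_
    · rintro _ ⟨a, b, -, -, -, rfl⟩
      exact measurableSet_Ioc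
    · intro u hu x hx
      obtain ⟨ε, hε, hball⟩ := Metric.isOpen_iff.1 hu x hx
      obtain ⟨a, ha, hac⟩ := exists_continuousAt_cdf μ (show x - ε < x by linarith)
      obtain ⟨b, hb, hbc⟩ := exists_continuousAt_cdf μ (show x < x + ε by linarith)
      refine ⟨Set.Ioc a b, ⟨a, b, ha.2.trans hb.1, hac, hbc, rfl⟩, Ioc_mem_nhds ha.2 hb.1, ?_⟩
      intro z hz
      apply hball
      rw [Real.ball_eq_Ioo]
      exact ⟨ha.1.trans hz.1, hz.2.trans_lt hb.2⟩
    · rintro _ ⟨a, b, hab, ha, hb, rfl⟩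
      rw [← NNReal.tendsto_coe]
      have := (hcdf b hb).sub (hcdf a ha)
      rw [← measureReal_Ioc_eq μ hab.le] at this
      refine this.congr fun N => ?_
      rw [← measureReal_Ioc_eq _ hab.le]
      rfl
  · intro h y hy
    have h0 : μ (frontier (Set.Iic y)) = 0 := by
      rw [frontier_Iic, ← ENNReal.coe_eq_zero, ProbabilityMeasure.ennreal_coeFn_eq_coeFn_toMeasure]
      exact (continuousAt_cdf_iff μ y).1 hy
    have h1 := ProbabilityMeasure.tendsto_measure_of_null_frontier_of_tendsto h h0
    rw [← NNReal.tendsto_coe] at h1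
    rw [← tendsto_add_atTop_iff_nat 1]
    simp only [← cdf_empiricalMeasure]
    simp only [cdf_eq_real]
    exact h1

theorem HasDistributionFunction.tendsto_charFun {f : ℕ → ℝ} {μ : ProbabilityMeasure ℝ}
    (h : HasDistributionFunction f μ) (t : ℝ) :
    Tendsto (fun N : ℕ => zSum f t N / N) atTop (𝓝 (charFun (μ : Measure ℝ) t)) := by
  have := ProbabilityMeasure.tendsto_iff_tendsto_charFun.1 ((hasDistributionFunction_iff f μ).1 h) t
  simp only [charFun_empiricalMeasure] at this
  exact (tendsto_add_atTop_iff_nat 1).1 this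

/-- Lévy's continuity theorem for the means of `e^{i t f}`: a pointwise limit continuous at `0` is
the characteristic function of a limiting distribution. -/
theorem exists_hasDistributionFunction {f : ℕ → ℝ} {φ : ℝ → ℂ} (hφ : ContinuousAt φ 0)
    (h : ∀ t, Tendsto (fun N : ℕ => zSum f t N / N) atTop (𝓝 (φ t))) :
    ∃ μ : ProbabilityMeasure ℝ, HasDistributionFunction f μ := by
  have hc : ∀ t, Tendsto (fun N => charFun (empiricalMeasure f N : Measure ℝ) t) atTop
      (𝓝 (φ t)) := by
    intro t
    simp only [charFun_empiricalMeasure]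
    exact (tendsto_add_atTop_iff_nat 1).2 (h t)
  have ht := isTightMeasureSet_of_tendsto_charFun hφ hc
  have hK : IsCompact (closure (Set.range (empiricalMeasure f))) := by
    apply isCompact_closure_of_isTightMeasureSet
    convert ht using 1
    ext ν; simp
  obtain ⟨μ, -, u, hu, hμ⟩ := hK.isSeqCompact (x := empiricalMeasure f)
    fun n => subset_closure (Set.mem_range_self n)
  refine ⟨μ, (hasDistributionFunction_iff f μ).2 ?_⟩
  rw [ProbabilityMeasure.tendsto_iff_tendsto_charFun]
  intro t
  have h1 := ProbabilityMeasure.tendsto_iff_tendsto_charFun.1 hμ t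
  have h2 := (hc t).comp hu.tendsto_atTop
  rw [tendsto_nhds_unique h1 h2]
  exact hc t

/-! ### Asymptotics of the twisted recursion for square-summable phases -/

theorem goldenRatio_ne_zero_complex : (Real.goldenRatio : ℂ) ≠ 0 := by
  exact_mod_cast Real.goldenRatio_ne_zero

theorem goldenRatio_sq_complex : (Real.goldenRatio : ℂ) ^ 2 = Real.goldenRatio + 1 := by
  exact_mod_cast Real.goldenRatio_sq

theorem sqrt_five_eq : Real.sqrt 5 = 2 * Real.goldenRatio - 1 := by
  unfold Real.goldenRatio; ring

theorem fib_succ_le_goldenRatio_pow (k : ℕ) : (Nat.fib (k + 1) : ℝ) ≤ Real.goldenRatio ^ k := by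
  have hg := Real.one_lt_goldenRatio
  induction k using Nat.twoStepInduction with
  | zero => simp
  | one => simpa using hg.le
  | more k h1 h2 =>
    rw [fib_cast_add_two (k + 1), pow_add, Real.goldenRatio_sq, mul_add, mul_one, ← pow_succ]
    simp only [add_assoc, Nat.reduceAdd] at *
    linarith

theorem tendsto_fib_div_goldenRatio_pow :
    Tendsto (fun k : ℕ => (Nat.fib (k + 1) : ℝ) / Real.goldenRatio ^ k) atTop
      (𝓝 (Real.goldenRatio / Real.sqrt 5)) := by
  have hg := Real.goldenRatio_pos
  have hr : |Real.goldenConj / Real.goldenRatio| < 1 := by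
    have h1 := Real.goldenConj_neg
    have h2 := Real.neg_one_lt_goldenConj
    have h3 := Real.one_lt_goldenRatio
    rw [abs_div, abs_of_neg h1, abs_of_pos hg, div_lt_one hg]
    linarith
  have h := (((tendsto_pow_atTop_nhds_zero_of_abs_lt_one hr).const_mul
    Real.goldenConj).const_sub Real.goldenRatio).div_const (Real.sqrt 5)
  rw [mul_zero, sub_zero] at h
  refine h.congr fun k => ?_
  have hk : Real.goldenRatio ^ k ≠ 0 := pow_ne_zero _ hg.ne'
  rw [Real.coe_fib_eq, div_pow, pow_succ, pow_succ]
  generalize Real.goldenRatio = g at *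
  generalize Real.goldenConj = c at *
  field_simp

/-- The coefficient of `(s_{k+1}, s_k)` along the dominant eigenvector `(γ, 1)` of the Fibonacci
matrix, times `√5` and divided by `γ ^ k`. -/
noncomputable def twistMain (e : ℕ → ℂ) (k : ℕ) : ℂ :=
  (fibTwist e (k + 1) + (Real.goldenRatio : ℂ)⁻¹ * fibTwist e k) / (Real.goldenRatio : ℂ) ^ k

/-- The coefficient of `(s_{k+1}, s_k)` along the contracting eigenvector `(1 / γ, -1)` of the
Fibonacci matrix, times `√5` and divided by `γ ^ k`. -/
noncomputable def twistRest (e : ℕ → ℂ) (k : ℕ) : ℂ :=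
  (fibTwist e (k + 1) - (Real.goldenRatio : ℂ) * fibTwist e k) / (Real.goldenRatio : ℂ) ^ k

/-- The constant `1 / (√5 γ)`: the limiting frequency of the digit `1`. -/
noncomputable def digitFreq : ℝ := (Real.sqrt 5 * Real.goldenRatio)⁻¹

theorem digitFreq_pos : 0 < digitFreq := by
  unfold digitFreq; have := Real.goldenRatio_pos; positivity

theorem digitFreq_le_one : digitFreq ≤ 1 := by
  have := Real.one_lt_goldenRatio
  rw [digitFreq, sqrt_five_eq]
  apply inv_le_one_of_one_le₀
  nlinarith

theorem twistMain_sub_twistRest (e : ℕ → ℂ) (k : ℕ) :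
    twistMain e k - twistRest e k =
      (Real.sqrt 5 : ℂ) * (fibTwist e k / (Real.goldenRatio : ℂ) ^ k) := by
  have h0 := goldenRatio_ne_zero_complex
  have h2 := goldenRatio_sq_complex
  rw [sqrt_five_eq, Complex.ofReal_sub, Complex.ofReal_mul, Complex.ofReal_ofNat,
    Complex.ofReal_one]
  unfold twistMain twistRest
  generalize (Real.goldenRatio : ℂ) = g at *
  field_simp
  linear_combination (-fibTwist e k) * h2

theorem digitFreq_mul (e : ℕ → ℂ) (k : ℕ) :
    (digitFreq : ℂ) * (twistMain e k - twistRest e k) =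
      (Real.goldenRatio : ℂ)⁻¹ * (fibTwist e k / (Real.goldenRatio : ℂ) ^ k) := by
  have h5 : (Real.sqrt 5 : ℂ) ≠ 0 := by
    exact_mod_cast (Real.sqrt_pos.2 (by norm_num : (0 : ℝ) < 5)).ne'
  rw [twistMain_sub_twistRest, digitFreq]
  push_cast
  field_simp

theorem twistMain_succ (e : ℕ → ℂ) (k : ℕ) :
    twistMain e (k + 1) = twistMain e k +
      (digitFreq : ℂ) * (e k - 1) * (twistMain e k - twistRest e k) := by
  have h0 := goldenRatio_ne_zero_complex
  have h2 := goldenRatio_sq_complex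
  rw [mul_right_comm, digitFreq_mul]
  unfold twistMain
  rw [fibTwist_add_two, pow_succ]
  field_simp
  linear_combination (-fibTwist e (k + 1)) * h2

theorem twistRest_succ (e : ℕ → ℂ) (k : ℕ) :
    twistRest e (k + 1) = -((Real.goldenRatio : ℂ) ^ 2)⁻¹ * twistRest e k +
      (e k - 1) * ((Real.goldenRatio : ℂ)⁻¹ * (fibTwist e k / (Real.goldenRatio : ℂ) ^ k)) := by
  have h0 := goldenRatio_ne_zero_complex
  have h2 := goldenRatio_sq_complex
  unfold twistRest
  rw [fibTwist_add_two, pow_succ]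
  field_simp
  linear_combination (-fibTwist e (k + 1)) * h2

theorem norm_fibTwist_div_le {e : ℕ → ℂ} (he : ∀ k, ‖e k‖ = 1) (k : ℕ) :
    ‖fibTwist e k / (Real.goldenRatio : ℂ) ^ k‖ ≤ 1 := by
  rw [norm_div, norm_pow, Complex.norm_real, Real.norm_of_nonneg Real.goldenRatio_pos.le]
  apply div_le_one_of_le₀ _ (pow_nonneg Real.goldenRatio_pos.le _)
  exact (norm_fibTwist_le_fib he k).trans (fib_succ_le_goldenRatio_pow k)

theorem norm_twistMain_le {e : ℕ → ℂ} (he : ∀ k, ‖e k‖ = 1) (k : ℕ) : ‖twistMain e k‖ ≤ 3 := by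
  have h0 := goldenRatio_ne_zero_complex
  have h1 := Real.one_lt_goldenRatio
  have h2 := Real.goldenRatio_lt_two
  have e1 : twistMain e k = (Real.goldenRatio : ℂ) *
      (fibTwist e (k + 1) / (Real.goldenRatio : ℂ) ^ (k + 1)) +
      (Real.goldenRatio : ℂ)⁻¹ * (fibTwist e k / (Real.goldenRatio : ℂ) ^ k) := by
    unfold twistMain; rw [pow_succ]; field_simp
  rw [e1]
  refine (norm_add_le _ _).trans ?_
  rw [norm_mul, norm_mul, norm_inv, Complex.norm_real, Real.norm_of_nonneg (by linarith)]
  have i1 : Real.goldenRatio⁻¹ ≤ 1 := inv_le_one_of_one_le₀ h1.le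
  have i0 : 0 ≤ Real.goldenRatio⁻¹ := by positivity
  have := norm_fibTwist_div_le he k
  have := norm_fibTwist_div_le he (k + 1)
  nlinarith [norm_nonneg (fibTwist e k / (Real.goldenRatio : ℂ) ^ k)]

theorem norm_twistRest_succ_le {e : ℕ → ℂ} (he : ∀ k, ‖e k‖ = 1) (k : ℕ) :
    ‖twistRest e (k + 1)‖ ≤ ‖twistRest e k‖ / 2 + ‖e k - 1‖ := by
  have h1 := Real.one_lt_goldenRatio
  rw [twistRest_succ]
  refine (norm_add_le _ _).trans ?_
  rw [norm_mul, norm_mul, norm_mul, norm_neg, norm_inv, norm_inv, norm_pow, Complex.norm_real,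
    Real.norm_of_nonneg (by linarith)]
  have i1 : Real.goldenRatio⁻¹ ≤ 1 := inv_le_one_of_one_le₀ h1.le
  have i0 : 0 ≤ Real.goldenRatio⁻¹ := by positivity
  have i2 : (Real.goldenRatio ^ 2)⁻¹ ≤ 2⁻¹ := by
    rw [Real.goldenRatio_sq]; gcongr; linarith
  have h3 := norm_fibTwist_div_le he k
  have h4 : Real.goldenRatio⁻¹ * ‖fibTwist e k / (Real.goldenRatio : ℂ) ^ k‖ ≤ 1 :=
    mul_le_one₀ i1 (norm_nonneg _) h3
  have h5 := mul_le_mul_of_nonneg_left h4 (norm_nonneg (e k - 1))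
  have h6 := mul_le_mul_of_nonneg_right i2 (norm_nonneg (twistRest e k))
  linarith

theorem norm_exp_sub_one_sub_le (x : ℝ) :
    ‖Complex.exp (Complex.I * x) - 1 - Complex.I * x‖ ≤ 3 * x ^ 2 := by
  have hx : ‖Complex.I * (x : ℂ)‖ = |x| := by simp
  rcases le_total |x| 1 with h | h
  · have := Complex.norm_exp_sub_one_sub_id_le (x := Complex.I * x) (by rw [hx]; exact h)
    rw [hx, sq_abs] at this
    nlinarith [sq_nonneg x]
  · have h1 : ‖Complex.exp (Complex.I * x)‖ = 1 := by
      rw [mul_comm, Complex.norm_exp_ofReal_mul_I]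
    refine (norm_sub_le _ _).trans ?_
    have := norm_sub_le (Complex.exp (Complex.I * x)) 1
    rw [h1, norm_one] at this
    rw [hx, ← sq_abs x]
    nlinarith

/-- To second order, averaging `e^{i x}` with weight `c` is the same as rotating by `c x`. -/
theorem norm_exp_mul_sub_one_le {c : ℝ} (hc0 : 0 ≤ c) (hc1 : c ≤ 1) (x : ℝ) :
    ‖Complex.exp (-(Complex.I * (c * x : ℝ))) * (1 + c * (Complex.exp (Complex.I * x) - 1)) - 1‖
      ≤ 6 * x ^ 2 := by
  have hn : ‖Complex.exp (-(Complex.I * (c * x : ℝ)))‖ = 1 := by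
    rw [← mul_neg, ← Complex.ofReal_neg, mul_comm, Complex.norm_exp_ofReal_mul_I]
  have e1 : Complex.exp (-(Complex.I * (c * x : ℝ))) *
      (1 + c * (Complex.exp (Complex.I * x) - 1)) - 1 =
      Complex.exp (-(Complex.I * (c * x : ℝ))) *
      (c * (Complex.exp (Complex.I * x) - 1 - Complex.I * x) -
        (Complex.exp (Complex.I * (c * x : ℝ)) - 1 - Complex.I * (c * x : ℝ))) := by
    have : Complex.exp (-(Complex.I * (c * x : ℝ))) * Complex.exp (Complex.I * (c * x : ℝ)) = 1 := by
      rw [← Complex.exp_add, neg_add_cancel, Complex.exp_zero]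
    push_cast at this ⊢
    linear_combination this
  rw [e1, norm_mul, hn, one_mul]
  refine (norm_sub_le _ _).trans ?_
  have h1 := norm_exp_sub_one_sub_le x
  have h2 := norm_exp_sub_one_sub_le (c * x)
  rw [norm_mul, Complex.norm_real, Real.norm_of_nonneg hc0]
  have h3 := mul_le_mul hc1 h1 (norm_nonneg _) zero_le_one
  have h4 : (c * x) ^ 2 ≤ x ^ 2 := by
    rw [mul_pow]; exact mul_le_of_le_one_left (sq_nonneg x) (by nlinarith)
  linarith

/-- The dominant coefficient after removing the drift `c (a_0 + ⋯ + a_{k-1})` from its phase. -/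
noncomputable def centredMain (a : ℕ → ℝ) (t : ℝ) (k : ℕ) : ℂ :=
  Complex.exp (-(Complex.I * (digitFreq * (t * ∑ j ∈ Finset.range k, a j) : ℝ))) *
    twistMain (phase a t) k

theorem norm_phase_sub_one_le (a : ℕ → ℝ) (t : ℝ) (k : ℕ) : ‖phase a t k - 1‖ ≤ |t * a k| := by
  have := Real.norm_exp_I_mul_ofReal_sub_one_le (x := t * a k)
  rw [Real.norm_eq_abs] at this
  refine le_trans (le_of_eq ?_) this
  rw [phase]; congr 3; push_cast; ring

theorem norm_centredMain_succ_sub_le (a : ℕ → ℝ) (t : ℝ) (k : ℕ) :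
    ‖centredMain a t (k + 1) - centredMain a t k‖ ≤
      18 * (t * a k) ^ 2 + |t * a k| * ‖twistRest (phase a t) k‖ := by
  have hn : ∀ x : ℝ, ‖Complex.exp (-(Complex.I * (x : ℂ)))‖ = 1 := fun x => by
    rw [← mul_neg, ← Complex.ofReal_neg, mul_comm, Complex.norm_exp_ofReal_mul_I]
  have hp : phase a t k = Complex.exp (Complex.I * (t * a k : ℝ)) := by
    rw [phase]; congr 1; push_cast; ring
  have e1 : centredMain a t (k + 1) - centredMain a t k =
      Complex.exp (-(Complex.I * (digitFreq * (t * ∑ j ∈ Finset.range k, a j) : ℝ))) *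
      ((Complex.exp (-(Complex.I * (digitFreq * (t * a k) : ℝ))) *
        (1 + digitFreq * (Complex.exp (Complex.I * (t * a k : ℝ)) - 1)) - 1) *
          twistMain (phase a t) k -
        Complex.exp (-(Complex.I * (digitFreq * (t * a k) : ℝ))) *
          (digitFreq * ((phase a t k - 1) * twistRest (phase a t) k))) := by
    unfold centredMain
    rw [Finset.sum_range_succ, twistMain_succ, ← hp]
    have : Complex.exp (-(Complex.I *
        (digitFreq * (t * (∑ j ∈ Finset.range k, a j + a k)) : ℝ))) =
        Complex.exp (-(Complex.I * (digitFreq * (t * ∑ j ∈ Finset.range k, a j) : ℝ))) *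
        Complex.exp (-(Complex.I * (digitFreq * (t * a k) : ℝ))) := by
      rw [← Complex.exp_add]; congr 1; push_cast; ring
    rw [this]; ring
  rw [e1, norm_mul, hn, one_mul]
  refine (norm_sub_le _ _).trans ?_
  rw [norm_mul, norm_mul, hn, one_mul, norm_mul, norm_mul, Complex.norm_real,
    Real.norm_of_nonneg digitFreq_pos.le]
  have h1 := norm_exp_mul_sub_one_le digitFreq_pos.le digitFreq_le_one (t * a k)
  have h2 := norm_twistMain_le (norm_phase a t) k
  have h3 := mul_le_mul h1 h2 (norm_nonneg _) (by positivity)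
  have h4 := mul_le_mul_of_nonneg_right (norm_phase_sub_one_le a t k)
    (norm_nonneg (twistRest (phase a t) k))
  have h5 := mul_le_mul_of_nonneg_right digitFreq_le_one (mul_nonneg
    (norm_nonneg (phase a t k - 1)) (norm_nonneg (twistRest (phase a t) k)))
  linarith

theorem tendsto_zero_of_summable_sq {y : ℕ → ℝ} (hy : Summable fun k => y k ^ 2) :
    Tendsto y atTop (𝓝 0) := by
  have := hy.tendsto_atTop_zero.sqrt
  simp only [Real.sqrt_sq_eq_abs, Real.sqrt_zero] at this
  exact tendsto_zero_iff_abs_tendsto_zero _ |>.2 this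

/-- The recursion `b_{k+1} = b_k / 2 + y_k` maps square-summable sequences to such. -/
theorem exists_summable_sq_majorant {y : ℕ → ℝ} (hy : Summable fun k => y k ^ 2) :
    ∃ b : ℕ → ℝ, b 0 = 1 ∧ (∀ k, b (k + 1) = b k / 2 + y k) ∧ Summable fun k => b k ^ 2 := by
  let b : ℕ → ℝ := fun n => Nat.rec 1 (fun k x => x / 2 + y k) n
  have h0 : b 0 = 1 := rfl
  have hs : ∀ k, b (k + 1) = b k / 2 + y k := fun k => rfl
  refine ⟨b, h0, hs, ?_⟩
  refine summable_of_sum_range_le (c := 2 + 4 * ∑' k, y k ^ 2) (fun k => sq_nonneg _) fun n => ?_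
  have h1 : ∑ k ∈ Finset.range (n + 1), b k ^ 2 ≤
      1 + (∑ k ∈ Finset.range n, b k ^ 2) / 2 + 2 * ∑ k ∈ Finset.range n, y k ^ 2 := by
    rw [Finset.sum_range_succ', h0, Finset.sum_div, Finset.mul_sum]
    have : ∑ k ∈ Finset.range n, b (k + 1) ^ 2 ≤
        ∑ k ∈ Finset.range n, (b k ^ 2 / 2 + 2 * y k ^ 2) := by
      refine Finset.sum_le_sum fun k _ => ?_
      rw [hs]; nlinarith [sq_nonneg (b k / 2 - y k)]
    rw [Finset.sum_add_distrib] at this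
    linarith
  rw [Finset.sum_range_succ] at h1
  have h2 := hy.sum_le_tsum (Finset.range n) fun k _ => sq_nonneg (y k)
  nlinarith [sq_nonneg (b n)]

theorem continuous_fibTwist_phase (a : ℕ → ℝ) (k : ℕ) :
    Continuous fun t => fibTwist (phase a t) k := by
  induction k using Nat.twoStepInduction with
  | zero => exact continuous_const
  | one => exact continuous_const
  | more k h1 h2 =>
    simp only [fibTwist_add_two]
    refine h2.add (Continuous.mul ?_ h1)
    unfold phase; fun_prop

theorem continuous_centredMain (a : ℕ → ℝ) (k : ℕ) : Continuous fun t => centredMain a t k := by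
  have h1 := continuous_fibTwist_phase a k
  have h2 := continuous_fibTwist_phase a (k + 1)
  unfold centredMain twistMain
  fun_prop

/-- Uniformly for bounded `t`, the increments of the centred main coefficient are summable and the
remaining coefficient tends to zero. -/
theorem exists_majorant {a : ℕ → ℝ} (ha : Summable fun k => a k ^ 2) (T : ℝ) :
    ∃ u b : ℕ → ℝ, Summable u ∧ Tendsto b atTop (𝓝 0) ∧ ∀ t, |t| ≤ T → ∀ k,
      ‖centredMain a t (k + 1) - centredMain a t k‖ ≤ u k ∧ ‖twistRest (phase a t) k‖ ≤ b k := by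
  have hy : Summable fun k => (T * |a k|) ^ 2 := by
    simpa only [mul_pow, sq_abs] using ha.mul_left (T ^ 2)
  obtain ⟨b, b0, bs, hb⟩ := exists_summable_sq_majorant hy
  refine ⟨fun k => 19 * (T * |a k|) ^ 2 + b k ^ 2, b, (hy.mul_left 19).add hb, ?_, ?_⟩
  · exact tendsto_zero_of_summable_sq hb
  · intro t ht k
    have hta : ∀ k, |t * a k| ≤ T * |a k| := fun k => by rw [abs_mul]; gcongr
    have hrest : ∀ k, ‖twistRest (phase a t) k‖ ≤ b k := by
      intro k
      induction k with
      | zero =>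
        have h1 := Real.one_lt_goldenRatio
        have h2 := Real.goldenRatio_lt_two
        have e : twistRest (phase a t) 0 = ((1 - Real.goldenRatio : ℝ) : ℂ) := by
          simp [twistRest, fibTwist]
        rw [e, b0, Complex.norm_real, Real.norm_eq_abs, abs_le]
        constructor <;> linarith
      | succ k ih =>
        have h1 := norm_twistRest_succ_le (norm_phase a t) k
        have h2 := norm_phase_sub_one_le a t k
        have h3 := hta k
        rw [bs]; linarith
    refine ⟨?_, hrest k⟩
    refine (norm_centredMain_succ_sub_le a t k).trans ?_
    have h1 := hta k
    have h2 := hrest k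
    have h3 : (t * a k) ^ 2 ≤ (T * |a k|) ^ 2 := by
      rw [← sq_abs (t * a k)]; gcongr
    have h4 : |t * a k| * ‖twistRest (phase a t) k‖ ≤ T * |a k| * b k := by
      gcongr
      exact (abs_nonneg _).trans h1
    nlinarith [sq_nonneg (T * |a k| - b k)]

/-- For square-summable `a`, the twisted Fibonacci sums, once the drift is removed, have limits that
depend continuously on `t` near `0` and do not vanish there. -/
theorem exists_tendsto_centred {a : ℕ → ℝ} (ha : Summable fun k => a k ^ 2) :
    ∃ Ψ : ℝ → ℂ, ContinuousAt Ψ 0 ∧ Ψ 0 = 1 ∧ ∀ t, Tendsto (fun k =>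
      Complex.exp (-(Complex.I * (digitFreq * (t * ∑ j ∈ Finset.range k, a j) : ℝ))) *
        (fibTwist (phase a t) k / Nat.fib (k + 1))) atTop (𝓝 (Ψ t)) := by
  have h5 : (Real.sqrt 5 : ℂ) ≠ 0 := by
    exact_mod_cast (Real.sqrt_pos.2 (by norm_num : (0 : ℝ) < 5)).ne'
  have hg0 := goldenRatio_ne_zero_complex
  let W : ℝ → ℂ := fun t => centredMain a t 0 +
    ∑' k, (centredMain a t (k + 1) - centredMain a t k)
  have hW : ∀ t, Tendsto (fun k => centredMain a t k) atTop (𝓝 (W t)) := by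
    intro t
    obtain ⟨u, b, hu, -, h⟩ := exists_majorant ha |t|
    have hs : Summable fun k => centredMain a t (k + 1) - centredMain a t k :=
      Summable.of_norm_bounded hu fun k => (h t le_rfl k).1
    have := hs.hasSum.tendsto_sum_nat.const_add (centredMain a t 0)
    refine this.congr fun n => ?_
    rw [Finset.sum_range_sub (fun k => centredMain a t k)]; ring
  have hWc : ContinuousAt W 0 := by
    obtain ⟨u, b, hu, -, h⟩ := exists_majorant ha 1
    have : ContinuousOn W (Set.Icc (-1) 1) := by
      refine (continuous_centredMain a 0).continuousOn.add ?_
      refine continuousOn_tsum (fun k => ?_) hu fun k t ht => (h t (abs_le.2 ht) k).1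
      exact ((continuous_centredMain a (k + 1)).sub (continuous_centredMain a k)).continuousOn
    exact this.continuousAt (Icc_mem_nhds (by norm_num) (by norm_num))
  have hfib : Tendsto (fun k : ℕ => ((Nat.fib (k + 1) : ℝ) : ℂ) / (Real.goldenRatio : ℂ) ^ k) atTop
      (𝓝 ((Real.goldenRatio : ℂ) / Real.sqrt 5)) := by
    have := (Complex.continuous_ofReal.tendsto _).comp tendsto_fib_div_goldenRatio_pow
    rw [Complex.ofReal_div] at this
    refine this.congr fun k => ?_
    simp
  have hlim : ∀ t, Tendsto (fun k =>
      Complex.exp (-(Complex.I * (digitFreq * (t * ∑ j ∈ Finset.range k, a j) : ℝ))) *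
        (fibTwist (phase a t) k / Nat.fib (k + 1))) atTop (𝓝 (W t / Real.goldenRatio)) := by
    intro t
    obtain ⟨u, b, -, hb, h⟩ := exists_majorant ha |t|
    have hR : Tendsto (fun k =>
        Complex.exp (-(Complex.I * (digitFreq * (t * ∑ j ∈ Finset.range k, a j) : ℝ))) *
          twistRest (phase a t) k) atTop (𝓝 0) := by
      refine squeeze_zero_norm (fun k => ?_) hb
      rw [norm_mul, ← mul_neg, ← Complex.ofReal_neg, mul_comm Complex.I,
        Complex.norm_exp_ofReal_mul_I, one_mul]
      exact (h t le_rfl k).2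
    have h1 := (((hW t).sub hR).div_const (Real.sqrt 5 : ℂ)).div hfib (div_ne_zero hg0 h5)
    have e : (W t - 0) / (Real.sqrt 5 : ℂ) / ((Real.goldenRatio : ℂ) / Real.sqrt 5) =
        W t / Real.goldenRatio := by
      field_simp; ring
    rw [e] at h1
    refine h1.congr fun k => ?_
    have hF : (Nat.fib (k + 1) : ℂ) ≠ 0 := by exact_mod_cast (fib_succ_pos k).ne'
    have h2 := twistMain_sub_twistRest (phase a t) k
    simp only [Pi.div_apply]
    rw [centredMain, ← mul_sub, h2]
    simp only [Complex.ofReal_natCast]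
    generalize (Real.goldenRatio : ℂ) = g at *
    field_simp
  refine ⟨fun t => W t / Real.goldenRatio, hWc.div_const _, ?_, hlim⟩
  refine tendsto_nhds_unique (hlim 0) ?_
  have : ∀ k, fibTwist (phase a 0) k = Nat.fib (k + 1) := by
    intro k
    induction k using Nat.twoStepInduction with
    | zero => simp [fibTwist]
    | one => simp [fibTwist]
    | more k h1 h2 =>
      rw [fibTwist_add_two, h1, h2, Nat.fib_add_two (n := k + 1)]
      simp [phase]; ring
  refine tendsto_const_nhds.congr fun k => ?_
  have hF : (Nat.fib (k + 1) : ℂ) ≠ 0 := by exact_mod_cast (fib_succ_pos k).ne'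
  rw [this k, div_self hF]; simp

/-! ### Necessity of the convergence of the two series -/

/-- The defect of `sinc` is at least of order `x ^ 2` near zero and stays bounded away from zero
elsewhere. -/
theorem min_sq_le_one_sub_sinc (x : ℝ) : min (x ^ 2) 4 / 40 ≤ 1 - Real.sinc x := by
  wlog hx : 0 < x generalizing x
  · rcases (not_lt.1 hx).eq_or_lt with h | h
    · simp [h]
    · have := this (-x) (by linarith)
      rwa [neg_sq, Real.sinc_neg] at this
  -- The range `x ≤ 2` is reduced to the Taylor bound on `[0, 1]` by halving the angle.
  have small : ∀ y : ℝ, 0 < y → y ≤ 1 → Real.sin y ≤ y * (1 - y ^ 2 / 10) := by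
    intro y hy hy1
    have h := (abs_le.1 (Real.sin_bound (x := y) (by rw [abs_of_pos hy]; exact hy1))).2
    rw [abs_of_pos hy] at h
    have : y ^ 5 ≤ y ^ 3 := pow_le_pow_of_le_one hy.le hy1 (by norm_num)
    have : 0 < y ^ 3 := by positivity
    linarith
  rw [Real.sinc_of_ne_zero hx.ne']
  rcases le_total x 2 with h2 | h2
  · have h1 : Real.sin x / x ≤ 1 - x ^ 2 / 40 := by
      rw [div_le_iff₀ hx]
      have hs := small (x / 2) (by linarith) (by linarith)
      have hs0 : 0 ≤ Real.sin (x / 2) :=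
        Real.sin_nonneg_of_nonneg_of_le_pi (by linarith) (by linarith [Real.pi_gt_three])
      have hc := Real.cos_le_one (x / 2)
      have : Real.sin x = 2 * Real.sin (x / 2) * Real.cos (x / 2) := by
        rw [← Real.sin_two_mul]; congr 1; ring
      rw [this]
      nlinarith [mul_le_mul_of_nonneg_left hc hs0]
    have := min_le_left (x ^ 2) 4
    linarith
  · have h1 : Real.sin x / x ≤ 1 / 2 := by
      rw [div_le_iff₀ hx]; linarith [Real.sin_le_one x]
    have := min_le_right (x ^ 2) 4
    linarith

theorem integral_cos_mul (x T : ℝ) : ∫ t in (0 : ℝ)..T, Real.cos (t * x) = T * Real.sinc (T * x) := by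
  rcases eq_or_ne x 0 with rfl | hx
  · simp
  rcases eq_or_ne T 0 with rfl | hT
  · simp
  rw [intervalIntegral.integral_comp_mul_right (fun t => Real.cos t) hx, integral_cos,
    Real.sinc_of_ne_zero (mul_ne_zero hT hx)]
  simp only [zero_mul, Real.sin_zero, sub_zero, smul_eq_mul]
  field_simp

/-- If the sums `∑ (1 - cos (t a_j))` are bounded for small `t`, then `a` is square-summable.
Integrating the hypothesis over `t ∈ [0, T]` avoids any discussion of `t a_j` modulo `2π`. -/
theorem summable_sq_of_sum_one_sub_cos_le {a : ℕ → ℝ} {T C : ℝ} (hT : 0 < T)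
    (h : ∀ t ∈ Set.Icc 0 T, ∀ K, ∑ j ∈ Finset.range K, (1 - Real.cos (t * a j)) ≤ C) :
    Summable fun j => a j ^ 2 := by
  have h1 : ∀ K, ∑ j ∈ Finset.range K, min ((T * a j) ^ 2) 4 ≤ 40 * C := by
    intro K
    have hint : ∀ j, IntervalIntegrable (fun t => 1 - Real.cos (t * a j)) volume 0 T := fun j =>
      Continuous.intervalIntegrable (by fun_prop) _ _
    have e : ∫ t in (0 : ℝ)..T, ∑ j ∈ Finset.range K, (1 - Real.cos (t * a j)) =
        T * ∑ j ∈ Finset.range K, (1 - Real.sinc (T * a j)) := by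
      rw [intervalIntegral.integral_finsetSum fun j _ => hint j, Finset.mul_sum]
      refine Finset.sum_congr rfl fun j _ => ?_
      rw [intervalIntegral.integral_sub (by simp) (Continuous.intervalIntegrable (by fun_prop) _ _),
        integral_cos_mul]
      simp; ring
    have h2 : ∫ t in (0 : ℝ)..T, ∑ j ∈ Finset.range K, (1 - Real.cos (t * a j)) ≤ T * C := by
      have := intervalIntegral.integral_mono_on (μ := volume) hT.le
        (f := fun t => ∑ j ∈ Finset.range K, (1 - Real.cos (t * a j))) (g := fun _ => C)
        (Continuous.intervalIntegrable (by fun_prop) _ _) (by simp) fun t ht => h t ht K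
      simpa using this
    rw [e] at h2
    have h3 := le_of_mul_le_mul_left h2 hT
    have h4 : ∑ j ∈ Finset.range K, min ((T * a j) ^ 2) 4 / 40 ≤
        ∑ j ∈ Finset.range K, (1 - Real.sinc (T * a j)) :=
      Finset.sum_le_sum fun j _ => min_sq_le_one_sub_sinc _
    rw [← Finset.sum_div] at h4
    linarith
  have h2 : Summable fun j => min ((T * a j) ^ 2) 4 :=
    summable_of_sum_range_le (fun j => le_min (sq_nonneg _) (by norm_num)) h1
  obtain ⟨N, hN⟩ := eventually_atTop.1
    (h2.tendsto_atTop_zero.eventually (gt_mem_nhds (by norm_num : (0 : ℝ) < 4)))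
  have h3 : Summable fun j => (T * a (j + N)) ^ 2 := by
    refine ((summable_nat_add_iff N).2 h2).congr fun j => ?_
    have := hN (j + N) (by omega)
    exact min_eq_left (by by_contra hlt; rw [min_eq_right (not_le.1 hlt).le] at this; linarith)
  rw [← summable_nat_add_iff N]
  refine (h3.mul_left ((T ^ 2)⁻¹)).congr fun j => ?_
  field_simp

theorem abs_le_two_mul_norm_exp_sub_one {x : ℝ} (hx : |x| ≤ 2) :
    |x| ≤ 2 * ‖Complex.exp (Complex.I * x) - 1‖ := by
  have hpi := Real.pi_gt_three
  have hpi4 := Real.pi_le_four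
  rw [Complex.norm_exp_I_mul_ofReal_sub_one, norm_mul, Real.norm_eq_abs, Real.norm_eq_abs,
    abs_of_pos (by norm_num : (0 : ℝ) < 2)]
  have h := Real.mul_abs_le_abs_sin (x := x / 2) (by
    rw [abs_div, abs_of_pos (by norm_num : (0 : ℝ) < 2)]; linarith)
  rw [abs_div, abs_of_pos (by norm_num : (0 : ℝ) < 2)] at h
  have h2 : 1 / 2 ≤ 2 / Real.pi := by
    rw [div_le_div_iff₀ (by norm_num) Real.pi_pos]; linarith
  nlinarith [abs_nonneg x]

/-- A real sequence with increments tending to zero converges if it converges modulo `2π`. -/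
theorem exists_tendsto_of_tendsto_exp {x : ℕ → ℝ} {z : ℂ}
    (hx : Tendsto (fun k => x (k + 1) - x k) atTop (𝓝 0))
    (h : Tendsto (fun k => Complex.exp (Complex.I * x k)) atTop (𝓝 z)) :
    ∃ y, Tendsto x atTop (𝓝 y) := by
  apply cauchySeq_tendsto_of_complete
  rw [Metric.cauchySeq_iff']
  intro ε hε
  obtain ⟨K1, h1⟩ := Metric.tendsto_atTop.1 hx 1 one_pos
  obtain ⟨K2, h2⟩ := Metric.cauchySeq_iff.1 h.cauchySeq (min ε 1 / 2) (by positivity)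
  refine ⟨max K1 K2, fun n hn => ?_⟩
  suffices |x n - x (max K1 K2)| < min ε 1 from this.trans_le (min_le_left _ _)
  induction n, hn using Nat.le_induction with
  | base => simpa using hε
  | succ n hn ih =>
    have h3 := h1 n ((le_max_left _ _).trans hn)
    rw [Real.dist_eq, sub_zero] at h3
    have h4 : |x (n + 1) - x (max K1 K2)| ≤ 2 := by
      have := abs_add_le (x (n + 1) - x n) (x n - x (max K1 K2))
      rw [sub_add_sub_cancel] at this
      have := min_le_right ε 1
      linarith
    have h5 := abs_le_two_mul_norm_exp_sub_one h4
    have h6 := h2 (n + 1) (by have := le_max_right K1 K2; omega) (max K1 K2) (le_max_right _ _)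
    rw [dist_eq_norm] at h6
    have h7 : ‖Complex.exp (Complex.I * (x (n + 1) - x (max K1 K2) : ℝ)) - 1‖ =
        ‖Complex.exp (Complex.I * x (n + 1)) - Complex.exp (Complex.I * x (max K1 K2))‖ := by
      have e : Complex.exp (Complex.I * x (n + 1)) - Complex.exp (Complex.I * x (max K1 K2)) =
          Complex.exp (Complex.I * x (max K1 K2)) *
            (Complex.exp (Complex.I * (x (n + 1) - x (max K1 K2) : ℝ)) - 1) := by
        rw [mul_sub, ← Complex.exp_add, mul_one]; congr 2; push_cast; ring
      rw [e, norm_mul, mul_comm Complex.I (x (max K1 K2) : ℂ), Complex.norm_exp_ofReal_mul_I, one_mul]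
    rw [h7] at h5
    linarith

section

variable {f : ℕ → ℝ} {μ : ProbabilityMeasure ℝ}

theorem HasDistributionFunction.tendsto_fibTwist (hf : IsZAdditive f)
    (h : HasDistributionFunction f μ) (t : ℝ) :
    Tendsto (fun k => fibTwist (phase (zCoeff f) t) k / Nat.fib (k + 1)) atTop
      (𝓝 (charFun (μ : Measure ℝ) t)) := by
  have hfib : Tendsto (fun k => Nat.fib (k + 1)) atTop atTop := by
    refine tendsto_atTop_mono (fun k => ?_) (tendsto_sub_atTop_nat 0)
    have := Nat.le_fib_add_one (k + 1)
    omega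
  refine ((h.tendsto_charFun t).comp hfib).congr fun k => ?_
  simp only [Function.comp_apply, zSum_fib hf]

/-- The decay of the twisted Fibonacci recursion passes to the characteristic function of the
limit. -/
theorem HasDistributionFunction.norm_charFun_pow_three_le (hf : IsZAdditive f)
    (h : HasDistributionFunction f μ) (t : ℝ) (K : ℕ) :
    ‖charFun (μ : Measure ℝ) t‖ ^ 3 ≤
      Real.exp (-(∑ j ∈ Finset.range K, (1 - Real.cos (t * zCoeff f (j + 1))) / 12)) := by
  refine le_of_tendsto ((h.tendsto_fibTwist hf t).norm.pow 3) ?_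
  filter_upwards [eventually_ge_atTop (K + 2)] with k hk
  have := norm_fibTwist_div_pow_three_le (norm_phase (zCoeff f) t) hk
  simpa only [re_phase] using this

/-- The characteristic function is close to `1` near `t = 0`, which bounds the exponent in
`norm_charFun_pow_three_le`. -/
theorem HasDistributionFunction.summable_sq (hf : IsZAdditive f)
    (h : HasDistributionFunction f μ) : Summable fun k => zCoeff f k ^ 2 := by
  rw [← summable_nat_add_iff 1]
  have hc : Tendsto (fun t => ‖charFun (μ : Measure ℝ) t‖ ^ 3) (𝓝 0) (𝓝 1) := by
    have : Continuous fun t => ‖charFun (μ : Measure ℝ) t‖ ^ 3 := by fun_prop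
    have := this.tendsto 0
    simpa using this
  obtain ⟨δ, hδ, hball⟩ := Metric.eventually_nhds_iff.1
    (hc.eventually (lt_mem_nhds (Real.exp_lt_one_iff.2 (by norm_num : (-1 : ℝ) < 0))))
  refine summable_sq_of_sum_one_sub_cos_le (T := δ / 2) (C := 12) (by positivity)
    fun t ht K => ?_
  have h1 := hball (y := t) (by
    rw [Real.dist_eq, sub_zero, abs_of_nonneg ht.1]; linarith [ht.2])
  have h2 := h1.trans_le (h.norm_charFun_pow_three_le hf t K)
  rw [Real.exp_lt_exp, ← Finset.sum_div] at h2
  linarith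

/-- Both the means of `e^{i t f}` and the same means with the drift removed converge to nonzero
limits for some `t ≠ 0`, so the drift converges. -/
theorem HasDistributionFunction.exists_tendsto_sum (hf : IsZAdditive f)
    (h : HasDistributionFunction f μ) :
    ∃ s, Tendsto (fun k => ∑ j ∈ Finset.range k, zCoeff f j) atTop (𝓝 s) := by
  have hsq := h.summable_sq hf
  obtain ⟨Ψ, hΨc, hΨ0, hΨ⟩ := exists_tendsto_centred hsq
  have hne : ∀ᶠ t in 𝓝[>] (0 : ℝ), Ψ t ≠ 0 :=
    (hΨc.eventually_ne (by rw [hΨ0]; exact one_ne_zero)).filter_mono nhdsWithin_le_nhds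
  obtain ⟨t, ht, ht0⟩ := (hne.and self_mem_nhdsWithin).exists
  have ht0 : 0 < t := ht0
  have h1 := h.tendsto_fibTwist hf t
  have h2 := hΨ t
  set A : ℕ → ℝ := fun k => ∑ j ∈ Finset.range k, zCoeff f j with hA
  have h3 := h1.div h2 ht
  have hd := digitFreq_pos
  have h4 : Tendsto (fun k => Complex.exp (Complex.I * (digitFreq * (t * A k) : ℝ))) atTop
      (𝓝 (charFun (μ : Measure ℝ) t / Ψ t)) := by
    refine h3.congr' ?_
    filter_upwards [h2.eventually_ne ht] with k hk
    have hk' := right_ne_zero_of_mul hk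
    simp only [Pi.div_apply]
    rw [Complex.exp_neg, hA, mul_comm, ← div_div, div_self hk', one_div, inv_inv]
  have ha := tendsto_zero_of_summable_sq hsq
  obtain ⟨y, hy⟩ := exists_tendsto_of_tendsto_exp (x := fun k => digitFreq * (t * A k)) (by
    have := (ha.const_mul t).const_mul digitFreq
    rw [mul_zero, mul_zero] at this
    refine this.congr fun k => ?_
    simp only [hA, Finset.sum_range_succ]; ring) h4
  refine ⟨(digitFreq * t)⁻¹ * y, (hy.const_mul _).congr fun k => ?_⟩
  field_simp

end

/-! ### Atoms of the limiting distribution -/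

theorem tendsto_sinc_mul_atTop {z : ℝ} (hz : z ≠ 0) :
    Tendsto (fun T : ℝ => Real.sinc (T * z)) atTop (𝓝 0) := by
  have h : Tendsto (fun T : ℝ => |z|⁻¹ * T⁻¹) atTop (𝓝 0) := by
    simpa using tendsto_inv_atTop_zero.const_mul (|z|⁻¹)
  refine squeeze_zero_norm' ?_ h
  filter_upwards [eventually_gt_atTop 0] with T hT
  rw [Real.sinc_of_ne_zero (mul_ne_zero hT.ne' hz), Real.norm_eq_abs, abs_div, abs_mul,
    abs_of_pos hT, ← mul_inv, ← one_div, mul_comm T |z|]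
  gcongr
  exact Real.abs_sin_le_one _

theorem integral_cos_mul_sub_le_norm_charFun (μ : ProbabilityMeasure ℝ) (x t : ℝ) :
    ∫ y, Real.cos (t * (y - x)) ∂(μ : Measure ℝ) ≤ ‖charFun (μ : Measure ℝ) t‖ := by
  have h1 : ∫ y, Real.cos (t * (y - x)) ∂(μ : Measure ℝ) =
      (Complex.exp ((-(t * x) : ℝ) * Complex.I) * charFun (μ : Measure ℝ) t).re := by
    rw [charFun_apply_real, ← integral_const_mul, ← RCLike.re_eq_complex_re, ← integral_re]
    · refine integral_congr_ae (Eventually.of_forall fun y => ?_)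
      simp only [RCLike.re_eq_complex_re]
      rw [← Complex.exp_add, ← Complex.exp_ofReal_mul_I_re]
      congr 2; push_cast; ring
    · refine Integrable.of_bound (C := 1) (Continuous.aestronglyMeasurable (by fun_prop))
        (Eventually.of_forall fun y => ?_)
      rw [norm_mul, Complex.norm_exp_ofReal_mul_I, ← Complex.ofReal_mul,
        Complex.norm_exp_ofReal_mul_I, one_mul]
  rw [h1]
  refine (Complex.re_le_norm _).trans ?_
  rw [norm_mul, Complex.norm_exp_ofReal_mul_I, one_mul]

theorem integral_sinc_eq (μ : ProbabilityMeasure ℝ) (x T : ℝ) :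
    ∫ t in (0 : ℝ)..T, ∫ y, Real.cos (t * (y - x)) ∂(μ : Measure ℝ) =
      T * ∫ y, Real.sinc (T * (y - x)) ∂(μ : Measure ℝ) := by
  have : IsFiniteMeasure (volume.restrict (Set.uIoc 0 T)) := ⟨by simp [Set.uIoc]⟩
  rw [intervalIntegral_integral_swap, ← integral_const_mul]
  · simp only [integral_cos_mul]
  · refine Integrable.of_bound (C := 1) (Continuous.aestronglyMeasurable ?_)
      (Eventually.of_forall fun p => Real.abs_cos_le_one _)
    fun_prop

/-- The kernels `sinc (T (y - x))` are bounded and tend to the indicator function of `x`. -/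
theorem tendsto_integral_sinc (μ : ProbabilityMeasure ℝ) (x : ℝ) :
    Tendsto (fun T : ℝ => ∫ y, Real.sinc (T * (y - x)) ∂(μ : Measure ℝ)) atTop
      (𝓝 ((μ : Measure ℝ).real {x})) := by
  have e : (μ : Measure ℝ).real {x} =
      ∫ y, Set.indicator {x} (fun _ => (1 : ℝ)) y ∂(μ : Measure ℝ) :=
    (integral_indicator_one (measurableSet_singleton x)).symm
  rw [e]
  refine tendsto_integral_filter_of_dominated_convergence (fun _ => 1)
    (Eventually.of_forall fun T => Continuous.aestronglyMeasurable (by fun_prop))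
    (Eventually.of_forall fun T => Eventually.of_forall fun y => Real.abs_sinc_le_one _)
    (integrable_const _) (Eventually.of_forall fun y => ?_)
  rcases eq_or_ne y x with rfl | hy
  · simp
  · rw [Set.indicator_of_notMem (by simpa using hy)]
    exact tendsto_sinc_mul_atTop (sub_ne_zero.2 hy)

/-- The mass of a point is bounded by the asymptotic mean of a majorant of the modulus of the
characteristic function. -/
theorem measureReal_singleton_le {μ : ProbabilityMeasure ℝ} {g : ℝ → ℝ} {c : ℝ}
    (hgc : Continuous g) (hg : ∀ t, ‖charFun (μ : Measure ℝ) t‖ ≤ g t)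
    (hc : Tendsto (fun T : ℝ => T⁻¹ * ∫ t in (0 : ℝ)..T, g t) atTop (𝓝 c)) (x : ℝ) :
    (μ : Measure ℝ).real {x} ≤ c := by
  refine le_of_tendsto_of_tendsto (tendsto_integral_sinc μ x) hc ?_
  filter_upwards [eventually_gt_atTop 0] with T hT
  rw [← div_eq_inv_mul, le_div_iff₀' hT, ← integral_sinc_eq]
  refine intervalIntegral.integral_mono_on hT.le ?_ (hgc.intervalIntegrable _ _)
    fun t _ => (integral_cos_mul_sub_le_norm_charFun μ x t).trans (hg t)
  refine Continuous.intervalIntegrable ?_ _ _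
  refine continuous_of_dominated (bound := fun _ => 1)
    (fun t => Continuous.aestronglyMeasurable (by fun_prop))
    (fun t => Eventually.of_forall fun y => Real.abs_cos_le_one _) (integrable_const _)
    (Eventually.of_forall fun y => by fun_prop)

theorem tendsto_mean_cos_mul_cos {x y : ℝ} (hs : x + y ≠ 0) :
    Tendsto (fun T : ℝ => T⁻¹ * ∫ t in (0 : ℝ)..T, Real.cos (t * x) * Real.cos (t * y)) atTop
      (𝓝 (if x = y then 1 / 2 else 0)) := by
  have e : ∀ T : ℝ, 0 < T → T⁻¹ * ∫ t in (0 : ℝ)..T, Real.cos (t * x) * Real.cos (t * y) =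
      (Real.sinc (T * (x - y)) + Real.sinc (T * (x + y))) / 2 := by
    intro T hT
    have : ∀ t, Real.cos (t * x) * Real.cos (t * y) =
        (Real.cos (t * (x - y)) + Real.cos (t * (x + y))) * 2⁻¹ := by
      intro t
      rw [mul_sub, mul_add, Real.cos_sub, Real.cos_add]; ring
    simp only [this]
    rw [intervalIntegral.integral_mul_const, intervalIntegral.integral_add
      (Continuous.intervalIntegrable (by fun_prop) _ _)
      (Continuous.intervalIntegrable (by fun_prop) _ _), integral_cos_mul, integral_cos_mul]
    field_simp
  have h2 := tendsto_sinc_mul_atTop hs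
  have h1 : Tendsto (fun T : ℝ => Real.sinc (T * (x - y))) atTop (𝓝 (if x = y then 1 else 0)) := by
    split_ifs with h
    · simp [h]
    · exact tendsto_sinc_mul_atTop (sub_ne_zero.2 h)
  have h3 := (h1.add h2).div_const 2
  have : ((if x = y then (1 : ℝ) else 0) + 0) / 2 = if x = y then 1 / 2 else 0 := by
    split_ifs <;> simp
  rw [this] at h3
  refine h3.congr' ?_
  filter_upwards [eventually_gt_atTop 0] with T hT
  rw [e T hT]

/-- Cosines of distinct positive frequencies are orthogonal in mean. -/
theorem tendsto_mean_sum_cos_sq {a : ℕ → ℝ} {J : Finset ℕ}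
    (hinj : Set.InjOn (fun j => |a j|) J) (h0 : ∀ j ∈ J, a j ≠ 0) :
    Tendsto (fun T : ℝ => T⁻¹ * ∫ t in (0 : ℝ)..T, (∑ j ∈ J, Real.cos (t * a j)) ^ 2) atTop
      (𝓝 (J.card / 2)) := by
  have e : ∀ T : ℝ, T⁻¹ * ∫ t in (0 : ℝ)..T, (∑ j ∈ J, Real.cos (t * a j)) ^ 2 =
      ∑ i ∈ J, ∑ j ∈ J, T⁻¹ * ∫ t in (0 : ℝ)..T, Real.cos (t * a i) * Real.cos (t * a j) := by
    intro T
    simp only [sq, Finset.sum_mul_sum]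
    rw [intervalIntegral.integral_finsetSum
      fun i _ => Continuous.intervalIntegrable (by fun_prop) _ _, Finset.mul_sum]
    refine Finset.sum_congr rfl fun i _ => ?_
    rw [intervalIntegral.integral_finsetSum
      fun i _ => Continuous.intervalIntegrable (by fun_prop) _ _, Finset.mul_sum]
  have hc : (J.card : ℝ) / 2 = ∑ i ∈ J, ∑ j ∈ J, if a i = a j then (1 / 2 : ℝ) else 0 := by
    have : ∀ i ∈ J, (∑ j ∈ J, if a i = a j then (1 / 2 : ℝ) else 0) = 1 / 2 := by
      intro i hi
      rw [Finset.sum_eq_single_of_mem i hi, if_pos rfl]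
      intro j hj hji
      rw [if_neg]
      intro h
      exact hji (hinj hj hi (by simp only [h]))
    rw [Finset.sum_congr rfl this, Finset.sum_const, nsmul_eq_mul]; ring
  rw [hc]
  simp only [e]
  refine tendsto_finsetSum _ fun i hi => tendsto_finsetSum _ fun j hj => ?_
  apply tendsto_mean_cos_mul_cos
  intro h
  have hij : i = j := hinj hi hj (by
    simp only; rw [eq_neg_of_add_eq_zero_left h, abs_neg])
  subst hij
  exact h0 i hi (by linarith)

/-- A null sequence that is not eventually zero takes infinitely many absolute values. -/
theorem exists_infinite_injOn_abs {a : ℕ → ℝ} (ha : Tendsto a atTop (𝓝 0))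
    (h : ∃ᶠ k in atTop, a k ≠ 0) :
    ∃ S : Set ℕ, S.Infinite ∧ Set.InjOn (fun j => |a j|) S ∧ ∀ j ∈ S, a j ≠ 0 := by
  have hinf : {k | a k ≠ 0}.Infinite := Nat.frequently_atTop_iff_infinite.1 h
  obtain ⟨S, hS, hbij⟩ := Set.exists_subset_bijOn {k | a k ≠ 0} (fun j => |a j|)
  -- If `S` were finite, the nonzero `|a j|` would be bounded below by some `δ > 0`.
  refine ⟨S, fun hfin => hinf ?_, hbij.injOn, fun j hj => hS hj⟩
  have hV : ((fun j => |a j|) '' {k | a k ≠ 0}).Finite := by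
    rw [← hbij.image_eq]; exact hfin.image _
  obtain ⟨δ, hδ, hδV⟩ : ∃ δ > 0, ∀ v ∈ (fun j => |a j|) '' {k | a k ≠ 0}, δ ≤ v := by
    rcases ((fun j => |a j|) '' {k | a k ≠ 0}).eq_empty_or_nonempty with he | hne
    · exact ⟨1, one_pos, by simp [he]⟩
    · obtain ⟨v, hv, hmin⟩ := Set.exists_min_image _ id hV hne
      refine ⟨v, ?_, hmin⟩
      obtain ⟨j, hj, rfl⟩ := hv
      exact abs_pos.2 hj
  obtain ⟨N, hN⟩ := Metric.tendsto_atTop.1 ha δ hδ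
  refine (Set.finite_lt_nat N).subset fun k hk => ?_
  by_contra hlt
  have h1 := hN k (not_lt.1 hlt)
  rw [Real.dist_eq, sub_zero] at h1
  exact absurd (hδV _ ⟨k, hk, rfl⟩) (not_le.2 h1)

section

variable {f : ℕ → ℝ} {μ : ProbabilityMeasure ℝ}

/-- Chebyshev's inequality in the variable `t`: outside a set of small density of `t`, the sum
`∑ cos (t a_j)` is at most half of its number of terms, and there the characteristic function is
exponentially small. -/
theorem HasDistributionFunction.norm_charFun_le_of_card (hf : IsZAdditive f)
    (h : HasDistributionFunction f μ) {J : Finset ℕ} (hJ : J.Nonempty) (t : ℝ) :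
    ‖charFun (μ : Measure ℝ) t‖ ≤ Real.exp (-(J.card / 72)) +
      4 / J.card ^ 2 * (∑ j ∈ J, Real.cos (t * zCoeff f (j + 1))) ^ 2 := by
  have hm : (0 : ℝ) < J.card := by exact_mod_cast hJ.card_pos
  set X := ∑ j ∈ J, Real.cos (t * zCoeff f (j + 1)) with hX
  rcases le_total X (J.card / 2) with hle | hle
  · refine le_trans ?_ (le_add_of_nonneg_right (by positivity))
    obtain ⟨K, hK⟩ := J.exists_nat_subset_range
    have h1 := h.norm_charFun_pow_three_le hf t K
    have h2 : ∑ j ∈ J, (1 - Real.cos (t * zCoeff f (j + 1))) / 12 ≤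
        ∑ j ∈ Finset.range K, (1 - Real.cos (t * zCoeff f (j + 1))) / 12 :=
      Finset.sum_le_sum_of_subset_of_nonneg hK fun j _ _ => by
        have := Real.cos_le_one (t * zCoeff f (j + 1)); linarith
    rw [← Finset.sum_div, Finset.sum_sub_distrib, Finset.sum_const, nsmul_eq_mul, mul_one] at h2
    refine le_of_pow_le_pow_left₀ (n := 3) (by norm_num) (Real.exp_pos _).le (h1.trans ?_)
    rw [← Real.exp_nat_mul, Real.exp_le_exp]
    push_cast
    linarith
  · refine le_trans ?_ (le_add_of_nonneg_left (Real.exp_pos _).le)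
    refine (norm_charFun_le_one t).trans ?_
    rw [div_mul_eq_mul_div, le_div_iff₀ (by positivity)]
    nlinarith

/-- If infinitely many of the values `f (F_j)` are nonzero, the limiting distribution is
continuous. -/
theorem HasDistributionFunction.measure_singleton_eq_zero (hf : IsZAdditive f)
    (h : HasDistributionFunction f μ) (hne : ∃ᶠ k in atTop, zCoeff f k ≠ 0) (x : ℝ) :
    (μ : Measure ℝ) {x} = 0 := by
  have hne' : ∃ᶠ k in atTop, zCoeff f (k + 1) ≠ 0 := by
    rw [frequently_atTop] at hne ⊢
    intro N
    obtain ⟨k, hk, hk0⟩ := hne (N + 1)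
    exact ⟨k - 1, by omega, by rwa [Nat.sub_add_cancel (by omega)]⟩
  obtain ⟨S, hS, hinj, h0⟩ := exists_infinite_injOn_abs (a := fun k => zCoeff f (k + 1))
    ((tendsto_add_atTop_iff_nat 1).2 (tendsto_zero_of_summable_sq (h.summable_sq hf))) hne'
  -- The mean of `X ^ 2` is `(m + 1) / 2` for `m + 1` frequencies, which gives the term `2 / (m + 1)`.
  have key : ∀ m : ℕ, (μ : Measure ℝ).real {x} ≤
      Real.exp (-(((m + 1 : ℕ) : ℝ) / 72)) + 2 / ((m + 1 : ℕ) : ℝ) := by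
    intro m
    obtain ⟨J, hJS, hJ⟩ := hS.exists_subset_card_eq (m + 1)
    have hmean := tendsto_mean_sum_cos_sq (hinj.mono hJS) fun j hj => h0 j (hJS hj)
    refine measureReal_singleton_le (g := fun t => Real.exp (-(J.card / 72)) +
      4 / J.card ^ 2 * (∑ j ∈ J, Real.cos (t * zCoeff f (j + 1))) ^ 2) (by fun_prop)
      (h.norm_charFun_le_of_card hf (Finset.card_pos.1 (by omega))) ?_ x
    have h1 := (hmean.const_mul (4 / (J.card : ℝ) ^ 2)).const_add (Real.exp (-(J.card / 72)))
    have e : Real.exp (-((J.card : ℝ) / 72)) + 4 / (J.card : ℝ) ^ 2 * ((J.card : ℝ) / 2) =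
        Real.exp (-(((m + 1 : ℕ) : ℝ) / 72)) + 2 / ((m + 1 : ℕ) : ℝ) := by
      rw [hJ]
      have : ((m + 1 : ℕ) : ℝ) ≠ 0 := by positivity
      field_simp
      ring
    rw [e] at h1
    refine h1.congr' ?_
    filter_upwards [eventually_gt_atTop 0] with T hT
    rw [intervalIntegral.integral_add (by simp) (Continuous.intervalIntegrable (by fun_prop) _ _),
      intervalIntegral.integral_const_mul, intervalIntegral.integral_const]
    simp only [sub_zero, smul_eq_mul]
    field_simp
  have hlim : Tendsto (fun m : ℕ => Real.exp (-(((m + 1 : ℕ) : ℝ) / 72)) + 2 / ((m + 1 : ℕ) : ℝ))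
      atTop (𝓝 0) := by
    have hcast : Tendsto (fun m : ℕ => ((m + 1 : ℕ) : ℝ)) atTop atTop :=
      tendsto_natCast_atTop_atTop.comp (tendsto_add_atTop_nat 1)
    have h1 := Real.tendsto_exp_neg_atTop_nhds_zero.comp
      (hcast.atTop_div_const (by norm_num : (0 : ℝ) < 72))
    have h2 := hcast.const_div_atTop 2
    simpa using h1.add h2
  have h3 := ge_of_tendsto' hlim key
  exact (measureReal_eq_zero_iff).1 (le_antisymm h3 measureReal_nonneg)

/-- A digit that contributes nothing can be dropped, so `f` takes all its values below some
`F_{K+2}`. -/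
theorem finite_range_of_eventually_zero (hf : IsZAdditive f)
    (h : ∀ᶠ k in atTop, zCoeff f k = 0) : (Set.range f).Finite := by
  obtain ⟨K, hK⟩ := eventually_atTop.1 h
  refine ((Set.finite_lt_nat (Nat.fib (K + 2))).image f).subset ?_
  rintro _ ⟨n, rfl⟩
  induction n using Nat.strong_induction_on with
  | _ n ih =>
    by_cases hn : n < Nat.fib (K + 2)
    · exact ⟨n, hn, rfl⟩
    · have hF : ∀ k, 0 < Nat.fib (k + 2) := fun k => Nat.fib_pos.2 (by omega)
      obtain ⟨k, m, hm, rfl⟩ := exists_eq_fib_add ((hF K).trans_le (not_lt.1 hn))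
      have hk : K ≤ k := by
        by_contra hlt
        have h3 : Nat.fib (k + 3) ≤ Nat.fib (K + 2) := Nat.fib_mono (by omega)
        have h4 : Nat.fib (k + 3) = Nat.fib (k + 1) + Nat.fib (k + 2) := Nat.fib_add_two
        omega
      rw [hf.map_fib_add hm, hK k hk, zero_add]
      exact ih m (by have := hF k; omega)

/-- For a function with finitely many values, both the proportions and the limit are constant just
to the right of any point. -/
theorem HasDistributionFunction.tendsto_of_finite_range (h : HasDistributionFunction f μ)
    (hfin : (Set.range f).Finite) (y : ℝ) :
    Tendsto (fun N : ℕ => empiricalDistribution f N y) atTop (𝓝 (cdf (μ : Measure ℝ) y)) := by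
  have hev : ∀ᶠ z in 𝓝[>] y, ∀ v ∈ Set.range f, v ≤ z → v ≤ y := by
    rw [(hfin.eventually_all)]
    intro v _
    rcases le_or_gt v y with hv | hv
    · exact Eventually.of_forall fun _ _ => hv
    · filter_upwards [nhdsWithin_le_nhds (gt_mem_nhds hv)] with z hz hvz
      exact absurd hvz (not_le.2 hz)
  have hval : ∀ᶠ z in 𝓝[>] y, ContinuousAt (cdf (μ : Measure ℝ)) z →
      Tendsto (fun N : ℕ => empiricalDistribution f N y) atTop (𝓝 (cdf (μ : Measure ℝ) z)) := by
    filter_upwards [hev, self_mem_nhdsWithin] with z hz hyz hc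
    have hyz : y < z := hyz
    refine (h z hc).congr fun N => ?_
    unfold empiricalDistribution
    rw [Finset.filter_congr (q := fun n => f n ≤ y) fun n _ =>
      ⟨fun hn => hz _ ⟨n, rfl⟩ hn, fun hn => hn.trans hyz.le⟩]
  have hfreq : ∃ᶠ z in 𝓝[>] y, ContinuousAt (cdf (μ : Measure ℝ)) z := by
    rw [(nhdsGT_basis y).frequently_iff]
    intro b hb
    obtain ⟨z, hz, hc⟩ := exists_continuousAt_cdf μ hb
    exact ⟨z, hz, hc⟩
  obtain ⟨z₀, hc₀, hz₀⟩ := (hfreq.and_eventually hval).exists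
  have hlim := hz₀ hc₀
  have hright : Tendsto (cdf (μ : Measure ℝ)) (𝓝[>] y) (𝓝 (cdf (μ : Measure ℝ) y)) :=
    ((cdf (μ : Measure ℝ)).right_continuous y).mono_left
      (nhdsWithin_mono _ Set.Ioi_subset_Ici_self)
  have heq : cdf (μ : Measure ℝ) y ∈ ({cdf (μ : Measure ℝ) z₀} : Set ℝ) := by
    refine isClosed_singleton.mem_of_frequently_of_tendsto ?_ hright
    refine (hfreq.and_eventually hval).mono fun z hz => ?_
    exact tendsto_nhds_unique (hz.2 hz.1) hlim
  rw [Set.mem_singleton_iff.1 heq]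
  exact hlim

/-- The proportions converge at every point: either the limit has no atoms, or `f` has finitely many
values. -/
theorem HasDistributionFunction.tendsto_empiricalDistribution (hf : IsZAdditive f)
    (h : HasDistributionFunction f μ) (y : ℝ) :
    Tendsto (fun N : ℕ => empiricalDistribution f N y) atTop (𝓝 (cdf (μ : Measure ℝ) y)) := by
  by_cases hne : ∃ᶠ k in atTop, zCoeff f k ≠ 0
  · exact h y ((continuousAt_cdf_iff μ y).2 (h.measure_singleton_eq_zero hf hne y))
  · rw [not_frequently] at hne
    exact h.tendsto_of_finite_range (finite_range_of_eventually_zero hf (by simpa using hne)) y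

end

/-! ### The Erdős–Wintner theorem for Zeckendorf expansions -/

theorem sum_Icc_two_eq (b : ℕ → ℝ) (k : ℕ) :
    ∑ j ∈ Finset.Icc 2 (k + 1), b j = ∑ j ∈ Finset.range k, b (j + 2) := by
  induction k with
  | zero => simp
  | succ k ih => rw [Finset.sum_Icc_succ_top (by omega), ih, Finset.sum_range_succ]

theorem seriesConvergesFromTwo_iff (b : ℕ → ℝ) : SeriesConvergesFromTwo b ↔
    ∃ s, Tendsto (fun k => ∑ j ∈ Finset.range k, b (j + 2)) atTop (𝓝 s) := by
  simp only [SeriesConvergesFromTwo, ← sum_Icc_two_eq]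
  exact exists_congr fun s => (tendsto_add_atTop_iff_nat 1).symm

theorem summable_sq_iff (f : ℕ → ℝ) : (Summable fun k => zCoeff f k ^ 2) ↔
    SeriesConvergesFromTwo fun j => f (Nat.fib j) ^ 2 := by
  rw [seriesConvergesFromTwo_iff]
  refine ⟨fun h => ⟨_, h.hasSum.tendsto_sum_nat⟩, fun ⟨s, hs⟩ => ?_⟩
  exact ⟨s, (hasSum_iff_tendsto_nat_of_nonneg (fun k => sq_nonneg _) s).2 hs⟩

/-- The limit of the means of `e^{i t f}` is the drift-free limit rotated by the limit of the
drift; it is continuous at `t = 0`, so Lévy's continuity theorem applies. -/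
theorem exists_hasDistributionFunction_of_converges {f : ℕ → ℝ} (hf : IsZAdditive f)
    (h1 : SeriesConvergesFromTwo fun j => f (Nat.fib j))
    (h2 : SeriesConvergesFromTwo fun j => f (Nat.fib j) ^ 2) :
    ∃ μ : ProbabilityMeasure ℝ, HasDistributionFunction f μ := by
  have hsq := (summable_sq_iff f).2 h2
  obtain ⟨s, hs⟩ := (seriesConvergesFromTwo_iff _).1 h1
  obtain ⟨Ψ, hΨc, -, hΨ⟩ := exists_tendsto_centred hsq
  refine exists_hasDistributionFunction
    (φ := fun t => Complex.exp (Complex.I * (digitFreq * (t * s) : ℝ)) * Ψ t) ?_ fun t => ?_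
  · exact ContinuousAt.mul (by fun_prop) hΨc
  · refine tendsto_zSum_div hf ?_ (tendsto_zero_of_summable_sq hsq)
    have h3 : Tendsto (fun k => Complex.exp (Complex.I *
        (digitFreq * (t * ∑ j ∈ Finset.range k, zCoeff f j) : ℝ))) atTop
        (𝓝 (Complex.exp (Complex.I * (digitFreq * (t * s) : ℝ)))) := by
      have hc : Continuous fun x : ℝ =>
        Complex.exp (Complex.I * (digitFreq * (t * x) : ℝ)) := by fun_prop
      exact (hc.tendsto s).comp hs
    refine (h3.mul (hΨ t)).congr fun k => ?_
    rw [← mul_assoc, ← Complex.exp_add, add_neg_cancel, Complex.exp_zero, one_mul]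

/-- By telescoping the partial product is `(√5 / γ) s_k / γ ^ k`, which is asymptotic to the mean
`s_k / F_{k+1}` of `e^{i t f}` over `n < F_{k+1}`. -/
theorem HasDistributionFunction.tendsto_prod_zRatio {f : ℕ → ℝ} {μ : ProbabilityMeasure ℝ}
    (hf : IsZAdditive f) (h : HasDistributionFunction f μ) {t : ℝ}
    (ht : ∀ j : ℕ, 2 ≤ j → zRatio f t j ≠ 0) :
    Tendsto (fun k : ℕ => ((Real.sqrt 5 / Real.goldenRatio : ℝ) : ℂ) *
      ∏ j ∈ Finset.Icc 2 k, zRatio f t j / (Real.goldenRatio : ℂ)) atTop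
      (𝓝 (charFun (μ : Measure ℝ) t)) := by
  rw [← tendsto_add_atTop_iff_nat 1]
  have hfib := (Complex.continuous_ofReal.tendsto _).comp
    (tendsto_fib_div_goldenRatio_pow.const_mul (Real.sqrt 5 / Real.goldenRatio))
  have h5 : Real.sqrt 5 ≠ 0 := (Real.sqrt_pos.2 (by norm_num : (0 : ℝ) < 5)).ne'
  have e : Real.sqrt 5 / Real.goldenRatio * (Real.goldenRatio / Real.sqrt 5) = 1 :=
    (div_mul_div_cancel₀ Real.goldenRatio_ne_zero).trans (div_self h5)
  rw [e, Complex.ofReal_one] at hfib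
  have h1 := hfib.mul (h.tendsto_fibTwist hf t)
  rw [one_mul] at h1
  refine h1.congr fun k => ?_
  have hF : (Nat.fib (k + 1) : ℂ) ≠ 0 := by exact_mod_cast (fib_succ_pos k).ne'
  rw [Finset.prod_div_distrib, prod_zRatio_eq ht, Finset.prod_const, Nat.card_Icc]
  simp only [Function.comp_apply, Complex.ofReal_mul, Complex.ofReal_div, Complex.ofReal_pow,
    Complex.ofReal_natCast]
  rw [mul_assoc, show k + 1 + 1 - 2 = k by omega]
  congr 1
  rw [div_mul_div_comm, mul_comm (Nat.fib (k + 1) : ℂ), mul_div_mul_right _ _ hF]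

theorem mainTheorem1 (f : ℕ → ℝ) (hf : IsZAdditive f) :
    ((∃ μ : ProbabilityMeasure ℝ, HasDistributionFunction f μ) ↔
      SeriesConvergesFromTwo (fun j => f (Nat.fib j)) ∧
        SeriesConvergesFromTwo (fun j => f (Nat.fib j) ^ 2)) ∧
    ∀ μ : ProbabilityMeasure ℝ, HasDistributionFunction f μ →
      (∀ y : ℝ, Tendsto (fun N : ℕ => empiricalDistribution f N y) atTop
        (𝓝 (cdf (μ : Measure ℝ) y))) ∧
      ∀ t : ℝ, (∀ j : ℕ, 2 ≤ j → zRatio f t j ≠ 0) →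
        Tendsto
          (fun k : ℕ => ((Real.sqrt 5 / Real.goldenRatio : ℝ) : ℂ) *
            ∏ j ∈ Finset.Icc 2 k, zRatio f t j / (Real.goldenRatio : ℂ))
          atTop (𝓝 (∫ y : ℝ, Complex.exp (Complex.I * (t : ℂ) * (y : ℂ)) ∂(μ : Measure ℝ))) := by
  refine ⟨⟨fun ⟨μ, h⟩ => ⟨?_, (summable_sq_iff f).1 (h.summable_sq hf)⟩,
    fun h => exists_hasDistributionFunction_of_converges hf h.1 h.2⟩,
    fun μ h => ⟨h.tendsto_empiricalDistribution hf, fun t ht => ?_⟩⟩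
  · exact (seriesConvergesFromTwo_iff _).2 (h.exists_tendsto_sum hf)
  · have e : ∫ y : ℝ, Complex.exp (Complex.I * (t : ℂ) * (y : ℂ)) ∂(μ : Measure ℝ) =
        charFun (μ : Measure ℝ) t := by
      rw [charFun_apply_real]
      refine integral_congr_ae (Eventually.of_forall fun y => ?_)
      simp only
      congr 1; ring
    rw [e]
    exact h.tendsto_prod_zRatio hf ht
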